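/- **Conventions.** A law $\mu$ on $\mathbb R$ is called nonsingular if it has finite second moment and $\mu=\delta p_c+(1-\delta)p_d$ with $\delta\in[0,1]$, $p_c$ an absolutely continuous probability law and $p_d$ a discrete probability law of finite entropy. A random vector belongs to $\mathcal L$ if it equals, almost surely, $A E_1^k$ for a real matrix $A$ and independent random variables $E_1,\dots,E_k$ with nonsingular laws. With $[x]_q=\lfloor qx\rfloor/q$ and $H$ the Shannon entropy in bits, the Rényi information dimensions are $$d(X)=\lim_{q\to\infty}\frac{H([X]_q)}{\log_2 q},\qquad d(X\mid Y)=\lim_{q\to\infty}\frac{H([X]_q\mid Y)}{\log_2 q},$$ where the conditioning is on the (unquantized) random vector $Y$. The Hadamard matrices are $H_1=[1]$, $H_{2N}=\begin{pmatrix}H_N&H_N\\H_N&-H_N\end{pmatrix}$. For $\alpha\in[0,1]$ and a word $b_1\dots b_n\in\{+,-\}^n$, the erasure process with initial value $\alpha$ is given by $e^{\emptyset}=\alpha$, $e^{b_1\dots b_n+}=2e^{b_1\dots b_n}-(e^{b_1\dots b_n})^2$, $e^{b_1\dots b_n-}=(e^{b_1\dots b_n})^2$. **Theorem (multi-terminal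 RID polarization).** Let $(X_i,Y_i)_{i\ge1}$ be i.i.d. pairs of real random variables with $(X_1,Y_1)\in\mathcal L$. For $n\ge 0$ and $N=2^n$ let $Z_1^N=H_NX_1^N$ and $W_1^N=H_NY_1^N$ (so $Z$ and $W$ depend on $n$), and for $i\in\{1,\dots,N\}$ set $$I_n(i)=d(Z_i\mid Z_1^{i-1}),\qquad J_n(i)=d(W_i\mid W_1^{i-1},Z_1^N).$$ Then the dimensions $d(X)=d(X_1)$, $d(Y|X)=d(Y_1|X_1)$ and all $I_n(i)$, $J_n(i)$ exist (as limits), $d(X),d(Y|X)\in[0,1]$, and $I$ and $J$ are erasure processes with initial values $d(X)$ and $d(Y|X)$: if $b_1\dots b_n$ is the binary expansion of $i-1$, most significant digit first, with $0$ replaced by $+$ and $1$ by $-$, and $I^{b_1\dots b_n}:=I_n(i)$, $J^{b_1\dots b_n}:=J_n(i)$, then $I^{b_1\dots b_n}=e^{b_1\dots b_n}$ for the erasure process started at $\alpha=d(X)$, and $J^{b_1\dots b_n}=e^{b_1\dots b_n}$ for the one started at $\alpha=d(Y|X)$. Moreover, let $B_1,B_2,\dots$ be i.i.d. uniform on $\{+,-\}$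 and $\mathcal F_n=\sigma(B_1,\dots,B_n)$. Then $(I^{B_1\dots B_n},\mathcal F_n)_{n\ge0}$ and $(J^{B_1\dots B_n},\mathcal F_n)_{n\ge0}$ are martingales, and both polarize to $\{0,1\}$: they converge almost surely to random variables $I_\infty,J_\infty$ with values in $\{0,1\}$, with $\mathbb P(I_\infty=1)=d(X)$ and $\mathbb P(J_\infty=1)=d(Y|X)$. -/

import Mathlib

open MeasureTheory ProbabilityTheory Filter Topology
open scoped ENNReal NNReal Matrix

noncomputable section

namespace RIDPolar

/-! ### Entropy and Renyi information dimension -/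

/-- Shannon entropy, in bits, of a discrete probability measure: `- ∑ μ{s} log₂ μ{s}`, in `[0, ∞]`.
Only used for measures carried by a countable set. -/
def entropy {S : Type*} [MeasurableSpace S] (μ : Measure S) : ℝ≥0∞ :=
  ∑' s : S, ENNReal.ofReal (Real.negMulLog (μ.real {s}) / Real.log 2)

/-- The uniform quantization `[x]_q = ⌊q x⌋ / q`. -/
def quant (q : ℕ) (x : ℝ) : ℝ := (⌊(q : ℝ) * x⌋ : ℝ) / q

/-- `H(D | Y)` for a discrete real random variable `D` and an arbitrary random element `Y`:
the average over `Y` of the entropy of the regular conditional law of `D` given `Y`. -/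
def condEntropy {Ω 𝓨 : Type*} [MeasurableSpace Ω] [MeasurableSpace 𝓨]
    (P : Measure Ω) [IsFiniteMeasure P] (D : Ω → ℝ) (Y : Ω → 𝓨) : ℝ≥0∞ :=
  ∫⁻ ω, entropy (condDistrib D Y P (Y ω)) ∂P

/-- The Renyi information dimension `d(X) = lim_q H([X]_q) / log₂ q` exists and equals `d`. -/
def HasRID {Ω : Type*} [MeasurableSpace Ω] (P : Measure Ω) (X : Ω → ℝ) (d : ℝ) : Prop :=
  (∀ᶠ q : ℕ in atTop, entropy (P.map fun ω => quant q (X ω)) ≠ ∞) ∧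
  Tendsto (fun q : ℕ => (entropy (P.map fun ω => quant q (X ω))).toReal / Real.logb 2 q)
    atTop (𝓝 d)

/-- The conditional Renyi information dimension `d(X | Y) = lim_q H([X]_q | Y) / log₂ q` exists
and equals `d`. -/
def HasCondRID {Ω 𝓨 : Type*} [MeasurableSpace Ω] [MeasurableSpace 𝓨]
    (P : Measure Ω) [IsFiniteMeasure P] (X : Ω → ℝ) (Y : Ω → 𝓨) (d : ℝ) : Prop :=
  (∀ᶠ q : ℕ in atTop, condEntropy P (fun ω => quant q (X ω)) Y ≠ ∞) ∧
  Tendsto (fun q : ℕ => (condEntropy P (fun ω => quant q (X ω)) Y).toReal / Real.logb 2 q)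
    atTop (𝓝 d)

/-! ### The space of linear images of independent nonsingular random variables -/

/-- A nonsingular law on `ℝ`: a mixture `a p_c + b p_d`, `a + b = 1`, of an absolutely continuous
probability law `p_c` and a discrete one `p_d`, where the discrete part has finite entropy and the
law has finite second moment. -/
def IsNonsingularLaw (μ : Measure ℝ) : Prop :=
  (∃ (a b : ℝ≥0) (pc pd : Measure ℝ), a + b = 1 ∧
    IsProbabilityMeasure pc ∧ IsProbabilityMeasure pd ∧
    pc ≪ volume ∧ (∃ S : Set ℝ, S.Countable ∧ pd Sᶜ = 0) ∧ entropy pd ≠ ∞ ∧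
    μ = a • pc + b • pd) ∧
  MemLp id 2 μ

/-- The `n`-dimensional random vector `V` is (almost surely) `A E` for a real matrix `A` and a
vector `E` of independent nonsingular random variables. -/
def InL {Ω : Type*} [MeasurableSpace Ω] (P : Measure Ω) {n : ℕ} (V : Ω → Fin n → ℝ) : Prop :=
  ∃ (k : ℕ) (A : Matrix (Fin n) (Fin k) ℝ) (E : Fin k → Ω → ℝ),
    (∀ j, Measurable (E j)) ∧ iIndepFun E P ∧ (∀ j, IsNonsingularLaw (P.map (E j))) ∧
    ∀ᵐ ω ∂P, V ω = A *ᵥ (fun j => E j ω)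

/-! ### The Hadamard transform -/

/-- The Hadamard matrix of order `2 ^ n`: `H_1 = [1]`, `H_{2N} = [H_N, H_N; H_N, -H_N]`. -/
def hadamard : (n : ℕ) → Matrix (Fin (2 ^ n)) (Fin (2 ^ n)) ℝ
  | 0 => 1
  | n + 1 =>
    let e : Fin (2 ^ n) ⊕ Fin (2 ^ n) ≃ Fin (2 ^ (n + 1)) :=
      finSumFinEquiv.trans (finCongr (by rw [pow_succ, mul_two]))
    Matrix.reindex e e
      (Matrix.fromBlocks (hadamard n) (hadamard n) (hadamard n) (-hadamard n))

/-- The `i`-th coordinate of `H_N X_1^N`, `N = 2 ^ n` (rows and columns are indexed from `0`). -/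
def transform {Ω : Type*} (X : ℕ → Ω → ℝ) (n : ℕ) (i : Fin (2 ^ n)) (ω : Ω) : ℝ :=
  (hadamard n *ᵥ (fun j : Fin (2 ^ n) => X j ω)) i

/-! ### Erasure processes -/

/-- The index `i ∈ {0, …, 2 ^ n - 1}` whose binary expansion, most significant digit first, is
`b 0, b 1, …, b (n - 1)`. The digit `false = 0` is the label `+`, the digit `true = 1` is `-`. -/
def pathIndex (b : ℕ → Bool) : (n : ℕ) → Fin (2 ^ n)
  | 0 => ⟨0, by norm_num⟩
  | n + 1 => ⟨2 * (pathIndex b n : ℕ) + (b n).toNat, by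
      have h := (pathIndex b n).isLt
      have h' := Bool.toNat_le (b n)
      rw [pow_succ]
      omega⟩

/-- The values `e^{b_1 … b_n}`: `e^∅ = α`, `e ↦ 2 e - e²` at a label `+` (`false`) and
`e ↦ e²` at a label `-` (`true`). -/
def erasureValue (α : ℝ) (b : ℕ → Bool) : ℕ → ℝ
  | 0 => α
  | n + 1 =>
    if b n then (erasureValue α b n) ^ 2
    else 2 * erasureValue α b n - (erasureValue α b n) ^ 2

/-- The array `I n i`, `0 ≤ i < 2 ^ n`, read along binary expansions of `i`, is the erasure process
with initial value `α`. -/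
def IsErasureProcess (α : ℝ) (I : (n : ℕ) → Fin (2 ^ n) → ℝ) : Prop :=
  α ∈ Set.Icc (0 : ℝ) 1 ∧
  ∀ (b : ℕ → Bool) (n : ℕ), I n (pathIndex b n) = erasureValue α b n

/-- The filtration `𝓕_n = σ(B_1, …, B_n)`; here `B k` is the `(k+1)`-st label. -/
def labelFiltration {Ω' : Type*} [m : MeasurableSpace Ω'] (B : ℕ → Ω' → Bool)
    (hB : ∀ k, Measurable (B k)) : Filtration ℕ m where
  seq n := ⨆ k : Fin n, MeasurableSpace.comap (B k) inferInstance
  mono' _ j hij := iSup_le fun k =>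
    le_iSup (fun k : Fin j => MeasurableSpace.comap (B k) inferInstance) (Fin.castLE hij k)
  le' _ := iSup_le fun k => (hB k).comap_le

/-- The stochastic process `I_n = I^{B_1 … B_n}`. -/
def labelProcess {Ω' : Type*} (B : ℕ → Ω' → Bool) (I : (n : ℕ) → Fin (2 ^ n) → ℝ)
    (n : ℕ) (ω : Ω') : ℝ :=
  I n (pathIndex (fun k => B k ω) n)

/-- The process `e` polarizes to `{0, 1}`: it converges almost surely to a `{0, 1}`-valued random
variable which equals `1` with probability `α`. -/
def PolarizesTo01 {Ω' : Type*} [MeasurableSpace Ω'] (Q : Measure Ω') (e : ℕ → Ω' → ℝ) (α : ℝ) :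
    Prop :=
  ∃ eInf : Ω' → ℝ, Measurable eInf ∧ (∀ ω, eInf ω = 0 ∨ eInf ω = 1) ∧
    (∀ᵐ ω ∂Q, Tendsto (fun n => e n ω) atTop (𝓝 (eInf ω))) ∧ Q.real {ω | eInf ω = 1} = α

end RIDPolar

end

/-! The law of a pair (U, V) is treated as an erasure channel. It is an erasure pair of parameter d
when it splits as ρ₀ + ρ₁, where ρ₁ has mass d and gives U a conditional density given V, while ρ₀
is carried by countably many graphs U = f(V), the graph being described by a code of finite mean
length. On ρ₀ the quantized U costs a bounded number of bits whatever q is; on ρ₁ it costs log q up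
to lower order. Hence d(U | V) exists and equals d (`IsErasurePair.hasCondRID`), and the entropies
can be forgotten: only the masses of the parts have to be followed.

For two independent erasure pairs of parameters α and β, the sum, given both side informations, is
determined up to countable ambiguity only when both variables are, so its parameter is α + β - αβ
(`IsErasurePair.add`). The difference, given also the sum, is determined as soon as one variable is,
so its parameter is αβ (`IsErasurePair.sub`). With α = β these are the two erasure maps. Since the
rows of H_{2N} are H_N applied to the sums, then H_N applied to the differences, a block at level n
+ 1 is a block at level n of the source transformed once, and induction on n gives the whole array
(`IsErasurePair.tree`).

The induction starts because two linear combinations of independent nonsingular variables form an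
erasure pair (`exists_isErasurePair_linear`). Split each law into its two parts and expand: in each
term the continuous summands span a subspace of the plane, the discrete ones translate it, and the
shape of that subspace alone decides between graph and conditional density.

Finally an erasure process moves by ± e(1 - e) with a fair sign. It is a bounded martingale, and its
limit must satisfy e(1 - e) = 0. -/

noncomputable section

namespace RIDPolar

/-! ### Quantized conditional entropy through an integer-valued kernel -/

/-- Shannon entropy, in nats, of a measure on the integers. -/
def natEntropy (μ : Measure ℤ) : ℝ≥0∞ := ∑' n : ℤ, ENNReal.ofReal (Real.negMulLog (μ.real {n}))

lemma entropy_map_of_injective (μ : Measure ℤ) {g : ℤ → ℝ} (hg : Function.Injective g) :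
    entropy (μ.map g) = natEntropy μ / ENNReal.ofReal (Real.log 2) := by
  have hgm : Measurable g := measurable_of_countable g
  have hval (n : ℤ) : (μ.map g).real {g n} = μ.real {n} := by
    rw [map_measureReal_apply hgm (measurableSet_singleton _)]
    congr 1
    ext m
    simp [hg.eq_iff]
  have hsupp : (Function.support fun s : ℝ =>
      ENNReal.ofReal (Real.negMulLog ((μ.map g).real {s}) / Real.log 2)) ⊆ Set.range g := by
    intro s hs
    by_contra hr
    apply hs
    have : (μ.map g).real {s} = 0 := by
      rw [map_measureReal_apply hgm (measurableSet_singleton _)]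
      have : g ⁻¹' {s} = ∅ := by
        ext m
        simp only [Set.mem_preimage, Set.mem_singleton_iff, Set.mem_empty_iff_false, iff_false]
        exact fun h => hr ⟨m, h⟩
      rw [this]
      simp
    simp only [this, Real.negMulLog_zero, zero_div, ENNReal.ofReal_zero]
  rw [entropy, ← hg.tsum_eq hsupp, natEntropy, ENNReal.div_eq_inv_mul, ← ENNReal.tsum_mul_left]
  refine tsum_congr fun n => ?_
  rw [hval, ENNReal.ofReal_div_of_pos (Real.log_pos one_lt_two), ENNReal.div_eq_inv_mul]

section Kernel

variable {Ω 𝓥 : Type*} [MeasurableSpace Ω] [MeasurableSpace 𝓥]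

lemma measurable_floor_mul {U : Ω → ℝ} (hU : Measurable U) (q : ℕ) :
    Measurable fun ω => ⌊(q : ℝ) * U ω⌋ :=
  Int.measurable_floor.comp (hU.const_mul _)

lemma div_injective {q : ℕ} (hq : q ≠ 0) : Function.Injective fun n : ℤ => (n : ℝ) / q := by
  intro a b h
  have : (q : ℝ) ≠ 0 := by exact_mod_cast hq
  have h' : (a : ℝ) = b := by simpa [div_left_inj' this] using h
  exact_mod_cast h'

/-- Dividing by q is injective, so only the integer cell matters. The factor log 2 converts nats to
bits. -/
lemma condEntropy_quant (P : Measure Ω) [IsFiniteMeasure P] {U : Ω → ℝ} {V : Ω → 𝓥}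
    (hU : Measurable U) (hV : Measurable V) {q : ℕ} (hq : q ≠ 0) :
    condEntropy P (fun ω => quant q (U ω)) V =
      (∫⁻ ω, natEntropy (condDistrib (fun ω => ⌊(q : ℝ) * U ω⌋) V P (V ω)) ∂P) /
        ENNReal.ofReal (Real.log 2) := by
  have hg : Measurable fun n : ℤ => (n : ℝ) / q := measurable_of_countable _
  have h := ae_of_ae_map hV.aemeasurable
    (condDistrib_comp V (measurable_floor_mul hU q).aemeasurable hg (μ := P))
  rw [condEntropy, ENNReal.div_eq_inv_mul, ← lintegral_const_mul' _ _
    (ENNReal.inv_ne_top.2 (ENNReal.ofReal_pos.2 (Real.log_pos one_lt_two)).ne')]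
  refine lintegral_congr_ae ?_
  filter_upwards [h] with ω hω
  have : (fun ω => quant q (U ω)) = (fun n : ℤ => (n : ℝ) / q) ∘ fun ω => ⌊(q : ℝ) * U ω⌋ := rfl
  rw [this, hω, Kernel.map_apply _ hg, entropy_map_of_injective _ (div_injective hq),
    ENNReal.div_eq_inv_mul]

lemma lintegral_condDistrib (P : Measure Ω) [IsFiniteMeasure P] {N : Ω → ℤ} {V : Ω → 𝓥}
    (hN : Measurable N) (hV : Measurable V) {f : 𝓥 → ℤ → ℝ≥0∞}
    (hf : ∀ n, Measurable fun v => f v n) :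
    ∫⁻ ω, ∑' n, f (V ω) n * condDistrib N V P (V ω) {n} ∂P = ∫⁻ ω, f (V ω) (N ω) ∂P := by
  have hf' : Measurable fun z : 𝓥 × ℤ => f z.1 z.2 := measurable_from_prod_countable_left hf
  calc ∫⁻ ω, ∑' n, f (V ω) n * condDistrib N V P (V ω) {n} ∂P
      = ∫⁻ v, ∑' n, f v n * condDistrib N V P v {n} ∂(P.map V) := by
        rw [lintegral_map _ hV]
        exact Measurable.tsum fun n =>
          (hf n).mul (Kernel.measurable_coe _ (measurableSet_singleton n))
    _ = ∫⁻ v, ∫⁻ n, f v n ∂(condDistrib N V P v) ∂(P.map V) := by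
        simp_rw [lintegral_countable']
    _ = ∫⁻ z, f z.1 z.2 ∂(P.map V ⊗ₘ condDistrib N V P) := by
        rw [Measure.lintegral_compProd hf']
    _ = ∫⁻ ω, f (V ω) (N ω) ∂P := by
        rw [compProd_map_condDistrib hN.aemeasurable, lintegral_map hf' (hV.prodMk hN)]

/-- This is log x ≤ x - 1 at x = r / p. The positive part is there because r may exceed 1, and the
code lengths are later read in `ℝ≥0∞`. -/
lemma negMulLog_add_le {p r : ℝ} (hp : 0 ≤ p) (hr : 0 < r) :
    Real.negMulLog p ≤ p * max 0 (-Real.log r) + r := by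
  rcases hp.eq_or_lt with rfl | hp
  · simpa using hr.le
  have h := Real.log_le_sub_one_of_pos (div_pos hr hp)
  rw [Real.log_div hr.ne' hp.ne'] at h
  have h1 : p * (Real.log r - Real.log p) ≤ r - p := by
    calc p * (Real.log r - Real.log p) ≤ p * (r / p - 1) := mul_le_mul_of_nonneg_left h hp.le
      _ = r - p := by field_simp
  have h2 : p * (-Real.log r) ≤ p * max 0 (-Real.log r) :=
    mul_le_mul_of_nonneg_left (le_max_right _ _) hp.le
  rw [Real.negMulLog]
  nlinarith

/-- Gibbs' inequality for an unnormalized comparison function. -/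
lemma natEntropy_le (μ : Measure ℤ) [IsFiniteMeasure μ] {r : ℤ → ℝ} (hr : ∀ n, 0 < r n) :
    natEntropy μ ≤ ∑' n, ENNReal.ofReal (-Real.log (r n)) * μ {n} +
      ∑' n, ENNReal.ofReal (r n) := by
  rw [natEntropy, ← ENNReal.tsum_add]
  refine ENNReal.tsum_le_tsum fun n => ?_
  refine (ENNReal.ofReal_le_ofReal (negMulLog_add_le measureReal_nonneg (hr n))).trans ?_
  have h : ENNReal.ofReal (max 0 (-Real.log (r n))) = ENNReal.ofReal (-Real.log (r n)) := by
    rw [ENNReal.ofReal_max, ENNReal.ofReal_zero, max_eq_right zero_le]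
  rw [ENNReal.ofReal_add (by positivity) (hr n).le, ENNReal.ofReal_mul measureReal_nonneg,
    ofReal_measureReal, h, mul_comm]

/-- Coding bound: any weight `r`, allowed to depend on the side information, serves as a code of
length -log `r`. It need not be normalized; its total mass costs only the additive constant `K`. -/
lemma lintegral_natEntropy_le (P : Measure Ω) [IsProbabilityMeasure P] {N : Ω → ℤ} {V : Ω → 𝓥}
    (hN : Measurable N) (hV : Measurable V) {r : 𝓥 → ℤ → ℝ} (hr : ∀ v n, 0 < r v n)
    (hrm : ∀ n, Measurable fun v => r v n) {K : ℝ≥0∞}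
    (hK : ∀ v, ∑' n, ENNReal.ofReal (r v n) ≤ K) :
    ∫⁻ ω, natEntropy (condDistrib N V P (V ω)) ∂P ≤
      ∫⁻ ω, ENNReal.ofReal (-Real.log (r (V ω) (N ω))) ∂P + K := by
  rw [← lintegral_condDistrib P hN hV (f := fun v n => ENNReal.ofReal (-Real.log (r v n)))
    (fun n => (Real.measurable_log.comp (hrm n)).neg.ennreal_ofReal)]
  calc ∫⁻ ω, natEntropy (condDistrib N V P (V ω)) ∂P
      ≤ ∫⁻ ω, (∑' n, ENNReal.ofReal (-Real.log (r (V ω) n)) * condDistrib N V P (V ω) {n} + K) ∂P :=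
        lintegral_mono fun ω => (natEntropy_le _ (hr (V ω))).trans (by gcongr; exact hK _)
    _ = _ := by rw [lintegral_add_right _ measurable_const]; simp

/-- A lower bound on entropy: letters of probability less than `c` contribute at least
`-log c` each unit of mass. -/
lemma natEntropy_ge (μ : Measure ℤ) [IsProbabilityMeasure μ] {c : ℝ} :
    ∑' n, {n : ℤ | μ.real {n} < c}.indicator (fun _ => ENNReal.ofReal (-Real.log c)) n * μ {n} ≤
      natEntropy μ := by
  refine ENNReal.tsum_le_tsum fun n => ?_
  by_cases hn : μ.real {n} < c
  · rw [Set.indicator_of_mem (by exact hn)]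
    rcases (measureReal_nonneg (μ := μ) (s := {n})).eq_or_lt with h0 | h0
    · have : μ {n} = 0 := by
        rw [← ofReal_measureReal, ← h0, ENNReal.ofReal_zero]
      simp [this]
    · rw [← ofReal_measureReal, ← ENNReal.ofReal_mul' measureReal_nonneg, Real.negMulLog]
      apply ENNReal.ofReal_le_ofReal
      have := Real.log_le_log h0 hn.le
      nlinarith
  · rw [Set.indicator_of_notMem (by exact hn)]
    simp

lemma lintegral_natEntropy_ge (P : Measure Ω) [IsFiniteMeasure P] {N : Ω → ℤ} {V : Ω → 𝓥}
    (hN : Measurable N) (hV : Measurable V) (c : ℝ) :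
    ENNReal.ofReal (-Real.log c) *
      P {ω | (condDistrib N V P (V ω)).real {N ω} < c} ≤
      ∫⁻ ω, natEntropy (condDistrib N V P (V ω)) ∂P := by
  have hm (n : ℤ) : MeasurableSet {v : 𝓥 | (condDistrib N V P v).real {n} < c} :=
    measurableSet_lt (Kernel.measurable_coe _ (measurableSet_singleton n)).ennreal_toReal
      measurable_const
  have hms : MeasurableSet {z : 𝓥 × ℤ | (condDistrib N V P z.1).real {z.2} < c} :=
    measurableSet_lt (measurable_from_prod_countable_left fun n =>
      (Kernel.measurable_coe _ (measurableSet_singleton n)).ennreal_toReal) measurable_const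
  have h := lintegral_condDistrib P hN hV (f := fun v n =>
    {n : ℤ | (condDistrib N V P v).real {n} < c}.indicator
      (fun _ => ENNReal.ofReal (-Real.log c)) n) (fun n => by
        have : (fun v => {n : ℤ | (condDistrib N V P v).real {n} < c}.indicator
            (fun _ => ENNReal.ofReal (-Real.log c)) n) =
            {v : 𝓥 | (condDistrib N V P v).real {n} < c}.indicator
              (fun _ => ENNReal.ofReal (-Real.log c)) := by
          ext v
          simp [Set.indicator]
        rw [this]
        exact measurable_const.indicator (hm n))
  refine le_trans (le_of_eq ?_) (h.symm.le.trans (lintegral_mono fun ω => natEntropy_ge _))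
  have : (fun ω => {n : ℤ | (condDistrib N V P (V ω)).real {n} < c}.indicator
      (fun _ => ENNReal.ofReal (-Real.log c)) (N ω)) =
      {ω | (condDistrib N V P (V ω)).real {N ω} < c}.indicator
        (fun _ => ENNReal.ofReal (-Real.log c)) := by
    ext ω
    simp [Set.indicator]
  rw [this, lintegral_indicator_const]
  exact hms.preimage (hV.prodMk hN)

end Kernel

/-! ### Decomposition of a joint law into graphs and an absolutely continuous part -/

/-- The first coordinate has a conditional density given the second one. -/
def IsAC {𝓥 : Type*} [MeasurableSpace 𝓥] (ρ : Measure (ℝ × 𝓥)) : Prop :=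
  ∃ ν : Measure 𝓥, SFinite ν ∧ ρ ≪ (volume : Measure ℝ).prod ν

/-- The measure is carried by countably many graphs over the second coordinate, and the graph can
be described by a code with finite mean length. -/
def IsGraph {𝓥 : Type*} [MeasurableSpace 𝓥] (ρ : Measure (ℝ × 𝓥)) : Prop :=
  ∃ (ι : Type) (_ : Countable ι) (f : ι → 𝓥 → ℝ) (ℓ : ι → ℝ≥0) (m : ι → Measure (ℝ × 𝓥)),
    (∀ i, Measurable (f i)) ∧ ρ = Measure.sum m ∧ (∀ i, ∀ᵐ z ∂(m i), z.1 = f i z.2) ∧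
    ∑' i, ENNReal.ofReal (Real.exp (-(ℓ i : ℝ))) ≠ ∞ ∧ ∑' i, m i Set.univ * ℓ i ≠ ∞

/-- The joint law of an integrable variable and a side information, which determines the variable
up to a discrete ambiguity on a part of mass `1 - d`, and leaves it a conditional density on the
rest. -/
def IsErasurePair {𝓥 : Type*} [MeasurableSpace 𝓥] (μ : Measure (ℝ × 𝓥)) (d : ℝ) : Prop :=
  Integrable Prod.fst μ ∧
    ∃ ρ₀ ρ₁ : Measure (ℝ × 𝓥), μ = ρ₀ + ρ₁ ∧ IsGraph ρ₀ ∧ IsAC ρ₁ ∧ ρ₁.real Set.univ = d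

/-! ### A code for the grid of mesh 1/q -/

/-- A subprobability weight on the integers, up to a constant, adapted to the grid of mesh
`1 / q`. -/
def gridWeight (q : ℕ) (n : ℤ) : ℝ := (q : ℝ)⁻¹ * (1 / 2) ^ (n / q).natAbs

lemma gridWeight_pos {q : ℕ} (hq : q ≠ 0) (n : ℤ) : 0 < gridWeight q n := by
  have : (0 : ℝ) < q := by exact_mod_cast Nat.pos_of_ne_zero hq
  unfold gridWeight
  positivity

lemma tsum_half_pow_natAbs_ne_top : ∑' n : ℤ, ENNReal.ofReal ((1 / 2) ^ n.natAbs) ≠ ∞ := by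
  have hs : Summable fun n : ℤ => (1 / 2 : ℝ) ^ n.natAbs :=
    Summable.of_nat_of_neg (by simpa using summable_geometric_two)
      (by simpa using summable_geometric_two)
  exact hs.tsum_ofReal_ne_top

/-- Each unit interval holds q cells of equal weight, so the total does not depend on q. This
uniformity makes the additive constants of the entropy bounds uniform. -/
lemma tsum_gridWeight {q : ℕ} (hq : q ≠ 0) :
    ∑' n, ENNReal.ofReal (gridWeight q n) = ∑' n : ℤ, ENNReal.ofReal ((1 / 2) ^ n.natAbs) := by
  have : NeZero q := ⟨hq⟩
  have hq0 : (0 : ℝ) < q := by exact_mod_cast Nat.pos_of_ne_zero hq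
  have h (n : ℤ) : gridWeight q n =
      (fun z : ℤ × Fin q => (q : ℝ)⁻¹ * (1 / 2) ^ z.1.natAbs) (Int.divModEquiv q n) := by
    simp [gridWeight, Int.divModEquiv]
  simp_rw [h]
  rw [(Int.divModEquiv q).tsum_eq fun z : ℤ × Fin q =>
    ENNReal.ofReal ((q : ℝ)⁻¹ * (1 / 2) ^ z.1.natAbs),
    ENNReal.tsum_prod (f := fun (n : ℤ) (_ : Fin q) =>
      ENNReal.ofReal ((q : ℝ)⁻¹ * (1 / 2) ^ n.natAbs))]
  refine tsum_congr fun n => ?_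
  rw [tsum_fintype, Finset.sum_const, Finset.card_univ, Fintype.card_fin, ← ENNReal.ofReal_nsmul,
    nsmul_eq_mul, mul_inv_cancel_left₀ hq0.ne']

lemma floor_mul_ediv {q : ℕ} (hq : q ≠ 0) (u : ℝ) : ⌊(q : ℝ) * u⌋ / (q : ℤ) = ⌊u⌋ := by
  exact Int.natCast_mul_floor_div_cancel hq u

lemma neg_log_gridWeight_le {q : ℕ} (hq : q ≠ 0) (u : ℝ) :
    -Real.log (gridWeight q ⌊(q : ℝ) * u⌋) ≤ Real.log q + (|u| + 1) := by
  have hq0 : (0 : ℝ) < q := by exact_mod_cast Nat.pos_of_ne_zero hq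
  rw [gridWeight, floor_mul_ediv hq, Real.log_mul (by positivity) (by positivity), Real.log_inv,
    Real.log_pow, one_div, Real.log_inv]
  have h1 : ((⌊u⌋.natAbs : ℕ) : ℝ) ≤ |u| + 1 := by
    rw [Nat.cast_natAbs, Int.cast_abs]
    have h := Int.floor_le u
    have h' := Int.lt_floor_add_one u
    rw [abs_le]
    constructor <;> cases abs_cases u <;> linarith
  have h2 := Real.log_two_lt_d9
  have h3 := Real.log_pos one_lt_two
  have h4 : (0 : ℝ) ≤ (⌊u⌋.natAbs : ℕ) := Nat.cast_nonneg _
  nlinarith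

/-! ### Upper and lower bounds on the quantized conditional entropy -/

section Bounds

variable {Ω 𝓥 : Type*} [MeasurableSpace Ω] [MeasurableSpace 𝓥]

/-- Upper bound on the quantized conditional entropy. -/
lemma exists_lintegral_natEntropy_le (P : Measure Ω) [IsProbabilityMeasure P] {U : Ω → ℝ}
    {V : Ω → 𝓥} (hU : Measurable U) (hV : Measurable V) {ρ₀ ρ₁ : Measure (ℝ × 𝓥)}
    (hint : Integrable Prod.fst (P.map fun ω => (U ω, V ω)))
    (hρ : (P.map fun ω => (U ω, V ω)) = ρ₀ + ρ₁) (hρ₀ : IsGraph ρ₀) :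
    ∃ C : ℝ≥0∞, C ≠ ∞ ∧ ∀ q : ℕ, q ≠ 0 →
      ∫⁻ ω, natEntropy (condDistrib (fun ω => ⌊(q : ℝ) * U ω⌋) V P (V ω)) ∂P ≤
        C + ρ₁ Set.univ * ENNReal.ofReal (Real.log q) := by
  obtain ⟨ι, _, f, ℓ, m, hf, rfl, hm, hkraft, hlen⟩ := hρ₀
  have hUV : Measurable fun ω => (U ω, V ω) := hU.prodMk hV
  set μ := P.map fun ω => (U ω, V ω) with hμ
  have : IsProbabilityMeasure μ := Measure.isProbabilityMeasure_map hUV.aemeasurable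
  set A : ℝ≥0∞ := ∑' i, m i Set.univ * ℓ i
  set D : ℝ≥0∞ := ∫⁻ z, ENNReal.ofReal (|z.1| + 1) ∂μ
  set K : ℝ≥0∞ := ∑' i, ENNReal.ofReal (Real.exp (-(ℓ i : ℝ))) +
    ∑' n : ℤ, ENNReal.ofReal ((1 / 2) ^ n.natAbs)
  have hD : D ≠ ∞ := by
    have := (hint.abs.add (integrable_const (1 : ℝ))).lintegral_lt_top
    exact this.ne
  refine ⟨A + D + K, ENNReal.add_ne_top.2 ⟨ENNReal.add_ne_top.2 ⟨hlen, hD⟩,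
    ENNReal.add_ne_top.2 ⟨hkraft, tsum_half_pow_natAbs_ne_top⟩⟩, fun q hq => ?_⟩
  classical
  -- Two codes are added. `s` gives a cell the weight exp(-ℓ i) for every graph i passing through it
  -- over `v`; the grid weight covers all cells. A point of graph i then costs at most ℓ i, and any
  -- point u costs at most log q + |u| + 1.
  set s : 𝓥 → ℤ → ℝ≥0∞ := fun v n =>
    ∑' i, if n = ⌊(q : ℝ) * f i v⌋ then ENNReal.ofReal (Real.exp (-(ℓ i : ℝ))) else 0 with hs
  have hsm (n : ℤ) : Measurable fun v => s v n := by
    refine Measurable.tsum fun i => Measurable.ite ?_ measurable_const measurable_const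
    exact measurableSet_eq_fun measurable_const (measurable_floor_mul (hf i) q)
  have hs_le (v : 𝓥) (n : ℤ) : s v n ≤ ∑' i, ENNReal.ofReal (Real.exp (-(ℓ i : ℝ))) := by
    refine ENNReal.tsum_le_tsum fun i => ?_
    split_ifs <;> simp
  have hs_top (v : 𝓥) (n : ℤ) : s v n ≠ ∞ := ne_top_of_le_ne_top hkraft (hs_le v n)
  have hs_sum (v : 𝓥) : ∑' n, s v n = ∑' i, ENNReal.ofReal (Real.exp (-(ℓ i : ℝ))) := by
    rw [hs, ENNReal.tsum_comm]
    exact tsum_congr fun i => tsum_ite_eq _ _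
  set r : 𝓥 → ℤ → ℝ := fun v n => (s v n).toReal + gridWeight q n
  have hr (v : 𝓥) (n : ℤ) : 0 < r v n :=
    add_pos_of_nonneg_of_pos ENNReal.toReal_nonneg (gridWeight_pos hq n)
  have hrm (n : ℤ) : Measurable fun v => r v n := (hsm n).ennreal_toReal.add_const _
  have hrK (v : 𝓥) : ∑' n, ENNReal.ofReal (r v n) ≤ K := by
    simp only [r, K]
    rw [← hs_sum v, ← tsum_gridWeight hq, ← ENNReal.tsum_add]
    refine ENNReal.tsum_le_tsum fun n => ?_
    rw [ENNReal.ofReal_add ENNReal.toReal_nonneg (gridWeight_pos hq n).le,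
      ENNReal.ofReal_toReal (hs_top v n)]
  have hrm' : Measurable fun z : ℝ × 𝓥 => ENNReal.ofReal (-Real.log (r z.2 ⌊(q : ℝ) * z.1⌋)) := by
    have h1 : Measurable fun z : 𝓥 × ℤ => r z.1 z.2 := measurable_from_prod_countable_left hrm
    have h2 : Measurable fun z : ℝ × 𝓥 => (z.2, ⌊(q : ℝ) * z.1⌋) :=
      measurable_snd.prodMk (measurable_floor_mul measurable_fst q)
    exact (Real.measurable_log.comp (h1.comp h2)).neg.ennreal_ofReal
  refine (lintegral_natEntropy_le P (measurable_floor_mul hU q) hV hr hrm hrK).trans ?_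
  have h1 : ∫⁻ ω, ENNReal.ofReal (-Real.log (r (V ω) ⌊(q : ℝ) * U ω⌋)) ∂P =
      ∑' i, ∫⁻ z, ENNReal.ofReal (-Real.log (r z.2 ⌊(q : ℝ) * z.1⌋)) ∂(m i) +
        ∫⁻ z, ENNReal.ofReal (-Real.log (r z.2 ⌊(q : ℝ) * z.1⌋)) ∂ρ₁ := by
    rw [← lintegral_sum_measure, ← lintegral_add_measure, ← hρ, hμ, lintegral_map hrm' hUV]
  have h2 (i : ι) : ∫⁻ z, ENNReal.ofReal (-Real.log (r z.2 ⌊(q : ℝ) * z.1⌋)) ∂(m i) ≤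
      m i Set.univ * ℓ i := by
    rw [mul_comm, ← lintegral_const]
    refine lintegral_mono_ae ?_
    filter_upwards [hm i] with z hz
    have h3 : Real.exp (-(ℓ i : ℝ)) ≤ r z.2 ⌊(q : ℝ) * z.1⌋ := by
      have h4 : ENNReal.ofReal (Real.exp (-(ℓ i : ℝ))) ≤ s z.2 ⌊(q : ℝ) * z.1⌋ := by
        refine le_trans (le_of_eq ?_) (ENNReal.le_tsum i)
        rw [if_pos (by rw [hz])]
      have h5 := (ENNReal.ofReal_le_iff_le_toReal (hs_top _ _)).1 h4
      have h6 := (gridWeight_pos hq ⌊(q : ℝ) * z.1⌋).le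
      simp only [r]
      linarith
    have h7 := Real.log_le_log (Real.exp_pos _) h3
    rw [Real.log_exp] at h7
    rw [← ENNReal.ofReal_coe_nnreal]
    exact ENNReal.ofReal_le_ofReal (by linarith)
  have h3 : ∫⁻ z, ENNReal.ofReal (-Real.log (r z.2 ⌊(q : ℝ) * z.1⌋)) ∂ρ₁ ≤
      ρ₁ Set.univ * ENNReal.ofReal (Real.log q) + D := by
    calc ∫⁻ z, ENNReal.ofReal (-Real.log (r z.2 ⌊(q : ℝ) * z.1⌋)) ∂ρ₁
        ≤ ∫⁻ z, (ENNReal.ofReal (Real.log q) + ENNReal.ofReal (|z.1| + 1)) ∂ρ₁ := by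
          refine lintegral_mono fun z => ?_
          rw [← ENNReal.ofReal_add (Real.log_natCast_nonneg q) (by positivity)]
          refine ENNReal.ofReal_le_ofReal (le_trans ?_ (neg_log_gridWeight_le hq z.1))
          refine neg_le_neg (Real.log_le_log (gridWeight_pos hq _) ?_)
          exact le_add_of_nonneg_left ENNReal.toReal_nonneg
      _ = ρ₁ Set.univ * ENNReal.ofReal (Real.log q) + ∫⁻ z, ENNReal.ofReal (|z.1| + 1) ∂ρ₁ := by
          rw [lintegral_add_left measurable_const, lintegral_const, mul_comm]
      _ ≤ _ := by
          gcongr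
          refine lintegral_mono' ?_ le_rfl
          rw [hρ]
          exact Measure.le_add_left le_rfl
  rw [h1]
  calc _ ≤ A + (ρ₁ Set.univ * ENNReal.ofReal (Real.log q) + D) + K := by
        gcongr
        exact ENNReal.tsum_le_tsum h2
    _ = _ := by ring

/-- The ε-δ form of absolute continuity, from uniform integrability of the single density of `μ`.
The lower entropy bound needs it because its exceptional set varies with q. -/
lemma exists_measure_lt_of_absolutelyContinuous {α : Type*} [MeasurableSpace α] {μ ν : Measure α}
    [IsFiniteMeasure μ] [SigmaFinite ν] (h : μ ≪ ν) {ε : ℝ≥0∞} (hε : ε ≠ 0) :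
    ∃ δ > 0, ∀ s, ν s < δ → μ s < ε := by
  obtain ⟨δ, hδ, H⟩ := exists_pos_setLIntegral_lt_of_measure_lt
    (Measure.lintegral_rnDeriv_lt_top μ ν).ne hε
  exact ⟨δ, hδ, fun s hs => by
    rw [← Measure.setLIntegral_rnDeriv h]
    exact H s hs⟩

lemma volume_floor_mul_eq_le {q : ℕ} (hq : q ≠ 0) (n : ℤ) :
    volume {u : ℝ | ⌊(q : ℝ) * u⌋ = n} ≤ ENNReal.ofReal ((q : ℝ)⁻¹) := by
  have hq0 : (0 : ℝ) < q := by exact_mod_cast Nat.pos_of_ne_zero hq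
  have h : {u : ℝ | ⌊(q : ℝ) * u⌋ = n} ⊆ Set.Ico (n / q : ℝ) ((n + 1) / q) := by
    intro u hu
    rw [Set.mem_ofPred_eq, Int.floor_eq_iff] at hu
    rw [Set.mem_Ico, div_le_iff₀ hq0, lt_div_iff₀ hq0]
    constructor <;> linarith [hu.1, hu.2]
  refine (measure_mono h).trans (le_of_eq ?_)
  rw [Real.volume_Ico]
  congr 1
  field_simp
  ring

/-- The cells of mesh `1 / q` with probability at least `M / q` have small total length. -/
lemma volume_heavy_cells_le (p : Measure ℤ) [IsProbabilityMeasure p] {q : ℕ} (hq : q ≠ 0) {M : ℝ}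
    (hM : 0 < M) :
    volume {u : ℝ | M / q ≤ p.real {⌊(q : ℝ) * u⌋}} ≤ ENNReal.ofReal M⁻¹ := by
  have hq0 : (0 : ℝ) < q := by exact_mod_cast Nat.pos_of_ne_zero hq
  have h : {u : ℝ | M / q ≤ p.real {⌊(q : ℝ) * u⌋}} ⊆
      ⋃ n : ℤ, {u : ℝ | ⌊(q : ℝ) * u⌋ = n ∧ M / q ≤ p.real {n}} := by
    intro u hu
    exact Set.mem_iUnion.2 ⟨_, rfl, hu⟩
  refine (measure_mono h).trans ((measure_iUnion_le _).trans ?_)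
  calc ∑' n : ℤ, volume {u : ℝ | ⌊(q : ℝ) * u⌋ = n ∧ M / q ≤ p.real {n}}
      ≤ ∑' n : ℤ, ENNReal.ofReal M⁻¹ * p {n} := by
        refine ENNReal.tsum_le_tsum fun n => ?_
        by_cases hn : M / q ≤ p.real {n}
        · simp only [hn, and_true]
          refine (volume_floor_mul_eq_le hq n).trans ?_
          rw [← ofReal_measureReal, ← ENNReal.ofReal_mul (by positivity)]
          refine ENNReal.ofReal_le_ofReal ?_
          calc (q : ℝ)⁻¹ = M⁻¹ * (M / q) := by field_simp
            _ ≤ _ := by gcongr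
        · simp [hn]
    _ = ENNReal.ofReal M⁻¹ := by
        rw [ENNReal.tsum_mul_left]
        have := lintegral_countable' (μ := p) fun _ => 1
        simp only [lintegral_one, measure_univ, one_mul] at this
        rw [← this, mul_one]

/-- Lower bound on the quantized conditional entropy. -/
lemma exists_le_lintegral_natEntropy (P : Measure Ω) [IsProbabilityMeasure P] {U : Ω → ℝ}
    {V : Ω → 𝓥} (hU : Measurable U) (hV : Measurable V) {ρ₁ : Measure (ℝ × 𝓥)}
    (hρ : ρ₁ ≤ P.map fun ω => (U ω, V ω)) (hρ₁ : IsAC ρ₁) {ε : ℝ} (hε : 0 < ε) :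
    ∃ M : ℝ, 0 < M ∧ ∀ q : ℕ, q ≠ 0 →
      ENNReal.ofReal (Real.log q - Real.log M) * ENNReal.ofReal (ρ₁.real Set.univ - ε) ≤
      ∫⁻ ω, natEntropy (condDistrib (fun ω => ⌊(q : ℝ) * U ω⌋) V P (V ω)) ∂P := by
  have hUV : Measurable fun ω => (U ω, V ω) := hU.prodMk hV
  have : IsProbabilityMeasure (P.map fun ω => (U ω, V ω)) :=
    Measure.isProbabilityMeasure_map hUV.aemeasurable
  have : IsFiniteMeasure ρ₁ := isFiniteMeasure_of_le _ hρ
  obtain ⟨ν', _, hac'⟩ := hρ₁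
  -- With a finite reference measure, the exceptional set below has product measure at most ν(univ)
  -- / M, which is small for large M.
  obtain ⟨ν, _, hν, -⟩ := exists_isFiniteMeasure_absolutelyContinuous ν'
  have hac : ρ₁ ≪ volume.prod ν := hac'.trans (Measure.AbsolutelyContinuous.rfl.prod hν)
  obtain ⟨δ, hδ, hδ'⟩ := exists_measure_lt_of_absolutelyContinuous hac
    (ENNReal.ofReal_pos.2 hε).ne'
  obtain ⟨M, hM, hMδ⟩ : ∃ M : ℝ, 0 < M ∧ ENNReal.ofReal M⁻¹ * ν Set.univ < δ := by
    have h1 : Tendsto (fun M : ℝ => ENNReal.ofReal M⁻¹ * ν Set.univ) atTop (𝓝 0) := by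
      have h2 : Tendsto (fun M : ℝ => ENNReal.ofReal M⁻¹) atTop (𝓝 0) := by
        simpa [Function.comp_def] using
          (ENNReal.continuous_ofReal.tendsto 0).comp (tendsto_inv_atTop_zero (𝕜 := ℝ))
      simpa using ENNReal.Tendsto.mul_const h2 (Or.inr (measure_ne_top ν _))
    obtain ⟨M, h3, h4⟩ := ((h1.eventually_lt_const hδ).and (eventually_gt_atTop 0)).exists
    exact ⟨M, h4, h3⟩
  refine ⟨M, hM, fun q hq => ?_⟩
  have hq0 : (0 : ℝ) < q := by exact_mod_cast Nat.pos_of_ne_zero hq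
  set κ := condDistrib (fun ω => ⌊(q : ℝ) * U ω⌋) V P
  have hκm : Measurable fun z : ℝ × 𝓥 => (κ z.2).real {⌊(q : ℝ) * z.1⌋} := by
    have h1 : Measurable fun z : 𝓥 × ℤ => (κ z.1).real {z.2} :=
      measurable_from_prod_countable_left fun n =>
        (Kernel.measurable_coe _ (measurableSet_singleton n)).ennreal_toReal
    exact h1.comp (measurable_snd.prodMk (measurable_floor_mul measurable_fst q))
  set S : Set (ℝ × 𝓥) := {z | M / q ≤ (κ z.2).real {⌊(q : ℝ) * z.1⌋}} with hS
  have hSm : MeasurableSet S := measurableSet_le measurable_const hκm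
  -- `S` is where the conditional probability of the cell is at least M/q. Each of its fibres has
  -- length at most 1/M for every q, so one M serves all q. Off `S` the surprisal exceeds log q -
  -- log M.
  have hSν : ρ₁ S < ENNReal.ofReal ε := by
    refine hδ' S (lt_of_le_of_lt ?_ hMδ)
    rw [Measure.prod_apply_symm hSm, ← lintegral_const]
    exact lintegral_mono fun v => volume_heavy_cells_le (κ v) hq hM
  have h1 := lintegral_natEntropy_ge P (measurable_floor_mul hU q) hV (M / q)
  rw [Real.log_div hM.ne' hq0.ne', neg_sub] at h1
  refine le_trans ?_ h1
  gcongr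
  have h2 : P {ω | (κ (V ω)).real {⌊(q : ℝ) * U ω⌋} < M / q} =
      (P.map fun ω => (U ω, V ω)) Sᶜ := by
    rw [Measure.map_apply hUV hSm.compl]
    congr 1
    ext ω
    simp [hS]
  rw [h2]
  refine le_trans ?_ (hρ _)
  rw [← ofReal_measureReal]
  refine ENNReal.ofReal_le_ofReal ?_
  rw [measureReal_compl hSm]
  have : ρ₁.real S ≤ ε := ENNReal.toReal_le_of_le_ofReal hε.le hSν.le
  linarith

/-- The information dimension of the first coordinate of an erasure pair, given the second. -/
theorem IsErasurePair.hasCondRID {P : Measure Ω} [IsProbabilityMeasure P] {U : Ω → ℝ} {V : Ω → 𝓥}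
    (hU : Measurable U) (hV : Measurable V) {d : ℝ}
    (h : IsErasurePair (P.map fun ω => (U ω, V ω)) d) : HasCondRID P U V d := by
  obtain ⟨hint, ρ₀, ρ₁, hρ, hρ₀, hρ₁, hd⟩ := h
  have hUV : Measurable fun ω => (U ω, V ω) := hU.prodMk hV
  have : IsProbabilityMeasure (P.map fun ω => (U ω, V ω)) :=
    Measure.isProbabilityMeasure_map hUV.aemeasurable
  have hle : ρ₁ ≤ P.map fun ω => (U ω, V ω) := by
    rw [hρ]
    exact Measure.le_add_left le_rfl
  have : IsFiniteMeasure ρ₁ := isFiniteMeasure_of_le _ hle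
  obtain ⟨C, hC, hup⟩ := exists_lintegral_natEntropy_le P hU hV hint hρ hρ₀
  set G : ℕ → ℝ≥0∞ := fun q =>
    ∫⁻ ω, natEntropy (condDistrib (fun ω => ⌊(q : ℝ) * U ω⌋) V P (V ω)) ∂P
  have hlog2 := Real.log_pos one_lt_two
  have hrhs (q : ℕ) : C + ρ₁ Set.univ * ENNReal.ofReal (Real.log q) ≠ ∞ :=
    ENNReal.add_ne_top.2 ⟨hC, ENNReal.mul_ne_top (measure_ne_top _ _) ENNReal.ofReal_ne_top⟩
  have hG (q : ℕ) (hq : q ≠ 0) : G q ≠ ∞ := ne_top_of_le_ne_top (hrhs q) (hup q hq)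
  have hcond (q : ℕ) (hq : q ≠ 0) :
      condEntropy P (fun ω => quant q (U ω)) V = G q / ENNReal.ofReal (Real.log 2) :=
    condEntropy_quant P hU hV hq
  have hev : ∀ᶠ q : ℕ in atTop, q ≠ 0 := eventually_ne_atTop 0
  have hlog : Tendsto (fun q : ℕ => Real.log q) atTop atTop :=
    Real.tendsto_log_atTop.comp tendsto_natCast_atTop_atTop
  refine ⟨hev.mono fun q hq => ?_, ?_⟩
  · rw [hcond q hq]
    exact ENNReal.div_ne_top (hG q hq) (ENNReal.ofReal_pos.2 hlog2).ne'
  have hlim : Tendsto (fun q : ℕ => (G q).toReal / Real.log q) atTop (𝓝 d) := by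
    refine tendsto_order.2 ⟨fun a ha => ?_, fun a ha => ?_⟩
    · obtain ⟨M, hM, hlow⟩ := exists_le_lintegral_natEntropy P hU hV hle hρ₁
        (ε := (d - a) / 2) (by linarith)
      have h1 : Tendsto (fun q : ℕ => (1 - Real.log M / Real.log q) * (d - (d - a) / 2)) atTop
          (𝓝 ((1 - 0) * (d - (d - a) / 2))) :=
        (tendsto_const_nhds.sub (hlog.const_div_atTop _)).mul_const _
      filter_upwards [hev,
        h1.eventually_const_lt (show a < (1 - 0) * (d - (d - a) / 2) by linarith),
        hlog.eventually_gt_atTop 0, hlog.eventually_ge_atTop (Real.log M)] with q hq h2 h3 h4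
      refine h2.trans_le ?_
      rw [le_div_iff₀ h3]
      have h5 := hlow q hq
      rw [← ENNReal.ofReal_mul (by linarith)] at h5
      have h6 := (ENNReal.ofReal_le_iff_le_toReal (hG q hq)).1 h5
      rw [hd] at h6
      refine le_trans (le_of_eq ?_) h6
      field_simp
    · have h1 : Tendsto (fun q : ℕ => C.toReal / Real.log q + d) atTop (𝓝 (0 + d)) :=
        (hlog.const_div_atTop _).add_const _
      filter_upwards [hev, h1.eventually_lt_const (show 0 + d < a by linarith),
        hlog.eventually_gt_atTop 0] with q hq h2 h3
      refine lt_of_le_of_lt ?_ h2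
      have h4 := ENNReal.toReal_mono (hrhs q) (hup q hq)
      rw [ENNReal.toReal_add hC (ENNReal.mul_ne_top (measure_ne_top _ _) ENNReal.ofReal_ne_top),
        ENNReal.toReal_mul, ENNReal.toReal_ofReal h3.le, ← measureReal_def, hd] at h4
      rw [div_le_iff₀ h3]
      refine h4.trans (le_of_eq ?_)
      field_simp
  refine hlim.congr' ?_
  filter_upwards [hev] with q hq
  rw [hcond q hq, ENNReal.toReal_div, ENNReal.toReal_ofReal hlog2.le, Real.logb,
    div_div_div_cancel_right₀ hlog2.ne']

lemma HasCondRID.hasRID {P : Measure Ω} [IsProbabilityMeasure P] {U : Ω → ℝ} (hU : Measurable U)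
    {c : 𝓥} {d : ℝ} (h : HasCondRID P U (fun _ => c) d) : HasRID P U d := by
  have key (q : ℕ) : condEntropy P (fun ω => quant q (U ω)) (fun _ => c) =
      entropy (P.map fun ω => quant q (U ω)) := by
    have hm : Measurable fun ω => quant q (U ω) := by
      have : Measurable fun n : ℤ => (n : ℝ) / q := measurable_of_countable _
      exact this.comp (measurable_floor_mul hU q)
    have h1 := condDistrib_ae_eq_of_measure_eq_compProd (μ := P) (fun _ => c) hm.aemeasurable
      (κ := Kernel.const _ (P.map fun ω => quant q (U ω))) (by
        rw [Measure.compProd_const, Measure.map_const, measure_univ, one_smul,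
          Measure.dirac_prod, Measure.map_map measurable_prodMk_left hm]
        rfl)
    have h2 := ae_of_ae_map (by fun_prop) h1
    rw [condEntropy, lintegral_congr_ae (g := fun _ => entropy (P.map fun ω => quant q (U ω)))]
    · simp
    · filter_upwards [h2] with ω hω
      rw [hω, Kernel.const_apply]
  simpa only [HasCondRID, HasRID, key] using h

end Bounds

/-! ### Operations preserving conditional densities -/

lemma quasiMeasurePreserving_linear_two {a b c d : ℝ} (h : a * d - b * c ≠ 0) :
    Measure.QuasiMeasurePreserving (fun p : ℝ × ℝ => (a * p.1 + b * p.2, c * p.1 + d * p.2))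
      ((volume : Measure ℝ).prod volume) ((volume : Measure ℝ).prod volume) := by
  set T : (ℝ × ℝ) →ₗ[ℝ] (ℝ × ℝ) :=
    Matrix.toLin (Module.Basis.finTwoProd ℝ) (Module.Basis.finTwoProd ℝ) !![a, b; c, d] with hT
  have hTf : (fun p : ℝ × ℝ => (a * p.1 + b * p.2, c * p.1 + d * p.2)) = T := by
    ext p <;> simp [hT, Matrix.toLin_finTwoProd_apply]
  have hdet : LinearMap.det T ≠ 0 := by
    rwa [hT, LinearMap.det_toLin, Matrix.det_fin_two_of]
  refine ⟨by fun_prop, ?_⟩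
  rw [hTf, Measure.map_linearMap_addHaar_eq_smul_addHaar _ hdet]
  exact Measure.smul_absolutelyContinuous

variable {𝓥 𝓦 𝓤 : Type*} [MeasurableSpace 𝓥] [MeasurableSpace 𝓦] [MeasurableSpace 𝓤]

lemma IsAC.mono {ρ ρ' : Measure (ℝ × 𝓥)} (h : IsAC ρ) (hle : ρ' ≪ ρ) : IsAC ρ' := by
  obtain ⟨ν, hν, h⟩ := h
  exact ⟨ν, hν, hle.trans h⟩

lemma IsAC.sum {ι : Type*} [Countable ι] {ρ : ι → Measure (ℝ × 𝓥)} (h : ∀ i, IsAC (ρ i)) :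
    IsAC (Measure.sum ρ) := by
  choose ν hν h using h
  refine ⟨Measure.sum ν, inferInstance, Measure.absolutelyContinuous_sum_left fun i => ?_⟩
  exact (h i).trans (Measure.AbsolutelyContinuous.rfl.prod
    (Measure.absolutelyContinuous_sum_right i Measure.AbsolutelyContinuous.rfl))

lemma IsAC.add {ρ ρ' : Measure (ℝ × 𝓥)} (h : IsAC ρ) (h' : IsAC ρ') : IsAC (ρ + ρ') := by
  obtain ⟨ν, hν, h⟩ := h
  obtain ⟨ν', hν', h'⟩ := h'
  refine ⟨ν + ν', inferInstance, ?_⟩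
  rw [Measure.prod_add]
  exact h.add h'

lemma isAC_zero : IsAC (0 : Measure (ℝ × 𝓥)) :=
  ⟨0, inferInstance, Measure.AbsolutelyContinuous.zero _⟩

/-- No injectivity of `g` is needed: a conditional density survives any loss of side information.
Graphs do not have this property. -/
lemma IsAC.map_snd {ρ : Measure (ℝ × 𝓥)} (h : IsAC ρ) {g : 𝓥 → 𝓦} (hg : Measurable g) :
    IsAC (ρ.map fun z => (z.1, g z.2)) := by
  obtain ⟨ν, hν, h⟩ := h
  refine ⟨ν.map g, inferInstance, (h.map (by fun_prop)).trans ?_⟩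
  have := Measure.map_prod_map (volume : Measure ℝ) ν measurable_id hg
  rw [Measure.map_id] at this
  rw [this]
  rfl

/-- On the fibre over v this is a translation by c(v), under which Lebesgue measure is invariant. -/
lemma IsAC.shear {ρ : Measure (ℝ × 𝓥)} (h : IsAC ρ) {c : 𝓥 → ℝ} (hc : Measurable c) :
    IsAC (ρ.map fun z => (z.1 + c z.2, z.2)) := by
  obtain ⟨ν, hν, h⟩ := h
  have hm : Measurable fun z : ℝ × 𝓥 => (z.1 + c z.2, z.2) := by fun_prop
  refine ⟨ν, hν, (h.map hm).trans (Measure.AbsolutelyContinuous.mk fun s hs h0 => ?_)⟩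
  rw [Measure.map_apply hm hs, Measure.prod_apply_symm (hm hs)]
  rw [Measure.prod_apply_symm hs] at h0
  rw [← h0]
  refine lintegral_congr fun v => ?_
  exact measure_preimage_add_right volume (c v) ((fun y => (y, v)) ⁻¹' s)

lemma IsAC.prod_right {ρ : Measure (ℝ × 𝓥)} (h : IsAC ρ) (σ : Measure 𝓦) [SFinite σ] :
    IsAC ((ρ.prod σ).map fun z => (z.1.1, (z.1.2, z.2))) := by
  obtain ⟨ν, hν, h⟩ := h
  refine ⟨ν.prod σ, inferInstance, ((h.prod (Measure.AbsolutelyContinuous.refl σ)).map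
    (by fun_prop)).trans ?_⟩
  rw [← Measure.prodAssoc_prod]
  rfl

/-- Adding a function of the side information and of an independent variable, and relabelling the
side information, preserve conditional densities. -/
lemma IsAC.map_prod {ρ : Measure (ℝ × 𝓥)} (h : IsAC ρ) (σ : Measure 𝓦) [SFinite σ]
    {c : 𝓥 × 𝓦 → ℝ} (hc : Measurable c) {g : 𝓥 × 𝓦 → 𝓤} (hg : Measurable g) :
    IsAC ((ρ.prod σ).map fun z => (z.1.1 + c (z.1.2, z.2), g (z.1.2, z.2))) := by
  have := ((h.prod_right σ).shear hc).map_snd hg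
  rw [Measure.map_map (by fun_prop) (by fun_prop), Measure.map_map (by fun_prop) (by fun_prop)]
    at this
  exact this

lemma map_prod_left_comm (ν : Measure 𝓥) (μ : Measure 𝓤) (ν' : Measure 𝓦) [SFinite ν] [SFinite μ]
    [SFinite ν'] :
    (ν.prod (μ.prod ν')).map (fun z => (z.2.1, (z.1, z.2.2))) = μ.prod (ν.prod ν') := by
  have h := Measure.map_prod_map (μ.prod ν) ν' measurable_swap measurable_id
  rw [Measure.map_id, Measure.prod_swap] at h
  rw [← Measure.prodAssoc_prod, ← Measure.prodAssoc_prod, h,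
    Measure.map_map (MeasurableEquiv.measurable _) (by fun_prop),
    Measure.map_map (by fun_prop) (by fun_prop)]
  rfl

lemma map_linear_two_prod_absolutelyContinuous {a b c d : ℝ} (h : a * d - b * c ≠ 0)
    (τ : Measure 𝓥) [SFinite τ] :
    ((volume : Measure ℝ).prod ((volume : Measure ℝ).prod τ)).map
      (fun z => (a * z.1 + b * z.2.1, (c * z.1 + d * z.2.1, z.2.2))) ≪
      (volume : Measure ℝ).prod ((volume : Measure ℝ).prod τ) := by
  have h1 := (QuasiMeasurePreserving.prodMap (quasiMeasurePreserving_linear_two h)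
    (Measure.QuasiMeasurePreserving.id τ)).absolutelyContinuous
  have h2 := h1.map (f := MeasurableEquiv.prodAssoc) (MeasurableEquiv.measurable _)
  rw [Measure.map_map (MeasurableEquiv.measurable _) (by fun_prop)] at h2
  rw [← Measure.prodAssoc_prod, Measure.map_map (by fun_prop) (MeasurableEquiv.measurable _)]
  exact h2

/-- The difference of two variables with conditional densities has a conditional density given the
sum. -/
lemma IsAC.map_sub_add {ρ : Measure (ℝ × 𝓥)} {ρ' : Measure (ℝ × 𝓦)} [SFinite ρ'] (h : IsAC ρ)
    (h' : IsAC ρ') :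
    IsAC ((ρ.prod ρ').map fun z => (z.1.1 - z.2.1, (z.1.1 + z.2.1, (z.1.2, z.2.2)))) := by
  obtain ⟨ν, hν, h⟩ := h
  obtain ⟨ν', hν', h'⟩ := h'
  -- The sum becomes part of the side information with Lebesgue reference measure: (x, x') ↦ (x -
  -- x', x + x') has determinant 2.
  refine ⟨(volume : Measure ℝ).prod (ν.prod ν'), inferInstance,
    ((h.prod h').map (by fun_prop)).trans ?_⟩
  have h1 := map_linear_two_prod_absolutelyContinuous (a := 1) (b := -1) (c := 1) (d := 1)
    (by norm_num) (ν.prod ν')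
  have h2 := Measure.map_prod_map (volume : Measure ℝ) (ν.prod ((volume : Measure ℝ).prod ν'))
    measurable_id (g := fun z => (z.2.1, (z.1, z.2.2))) (by fun_prop)
  rw [map_prod_left_comm, Measure.map_id] at h2
  have h3 : ((volume.prod ν).prod (volume.prod ν')).map
      (fun z : (ℝ × 𝓥) × (ℝ × 𝓦) => (z.1.1 - z.2.1, (z.1.1 + z.2.1, (z.1.2, z.2.2)))) =
      ((volume : Measure ℝ).prod ((volume : Measure ℝ).prod (ν.prod ν'))).map
        (fun z => (1 * z.1 + -1 * z.2.1, (1 * z.1 + 1 * z.2.1, z.2.2))) := by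
    rw [h2, ← Measure.prodAssoc_prod (μ := volume) (ν := ν),
      Measure.map_map (by fun_prop) (MeasurableEquiv.measurable _),
      Measure.map_map (by fun_prop) (by fun_prop)]
    refine congrArg (fun F => Measure.map F _) ?_
    ext z <;> simp [MeasurableEquiv.prodAssoc, sub_eq_add_neg]
  rw [h3]
  exact h1

/-! ### Graph parts -/

lemma IsGraph.add {ρ ρ' : Measure (ℝ × 𝓥)} (h : IsGraph ρ) (h' : IsGraph ρ') :
    IsGraph (ρ + ρ') := by
  obtain ⟨ι, _, f, ℓ, m, hf, rfl, hm, hk, hl⟩ := h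
  obtain ⟨ι', _, f', ℓ', m', hf', rfl, hm', hk', hl'⟩ := h'
  have key (a : ι → ℝ≥0∞) (b : ι' → ℝ≥0∞) :
      ∑' i, Sum.elim a b i = ∑' i, a i + ∑' i, b i :=
    ENNReal.summable.tsum_sum ENNReal.summable
  refine ⟨ι ⊕ ι', inferInstance, Sum.elim f f', Sum.elim ℓ ℓ', Sum.elim m m', ?_, ?_, ?_, ?_, ?_⟩
  · rintro (i | i)
    exacts [hf i, hf' i]
  · ext s hs
    rw [Measure.add_apply, Measure.sum_apply _ hs, Measure.sum_apply _ hs, Measure.sum_apply _ hs,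
      ← key]
    refine tsum_congr ?_
    rintro (i | i) <;> rfl
  · rintro (i | i)
    exacts [hm i, hm' i]
  · have := key (fun i => ENNReal.ofReal (Real.exp (-(ℓ i : ℝ))))
      (fun i => ENNReal.ofReal (Real.exp (-(ℓ' i : ℝ))))
    refine ne_of_eq_of_ne ((tsum_congr ?_).trans this) (ENNReal.add_ne_top.2 ⟨hk, hk'⟩)
    rintro (i | i) <;> rfl
  · have := key (fun i => m i Set.univ * ℓ i) (fun i => m' i Set.univ * ℓ' i)
    refine ne_of_eq_of_ne ((tsum_congr ?_).trans this) (ENNReal.add_ne_top.2 ⟨hl, hl'⟩)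
    rintro (i | i) <;> rfl

lemma isGraph_zero : IsGraph (0 : Measure (ℝ × 𝓥)) :=
  ⟨Empty, inferInstance, fun i => i.elim, fun i => i.elim, fun i => i.elim, fun i => i.elim,
    by simp, fun i => i.elim, by simp, by simp⟩

/-- If the new variable is a function of the new side information on each graph, the image is
again carried by graphs. -/
lemma IsGraph.map {ρ : Measure (ℝ × 𝓥)} (h : IsGraph ρ) {Ψ : ℝ × 𝓥 → ℝ × 𝓤} (hΨ : Measurable Ψ)
    (H : ∀ f : 𝓥 → ℝ, Measurable f → ∃ k : 𝓤 → ℝ, Measurable k ∧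
      ∀ᵐ z ∂ρ, z.1 = f z.2 → (Ψ z).1 = k (Ψ z).2) :
    IsGraph (ρ.map Ψ) := by
  obtain ⟨ι, _, f, ℓ, m, hf, rfl, hm, hk, hl⟩ := h
  choose k hkm hkf using fun i => H (f i) (hf i)
  refine ⟨ι, inferInstance, k, ℓ, fun i => (m i).map Ψ, hkm, Measure.map_sum hΨ.aemeasurable,
    fun i => ?_, hk, ?_⟩
  · refine (ae_map_iff hΨ.aemeasurable (p := fun z => z.1 = k i z.2)
      (measurableSet_eq_fun measurable_fst ((hkm i).comp measurable_snd))).2 ?_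
    filter_upwards [hm i, ae_mono (Measure.le_sum m i) (hkf i)] with z hz hz'
    exact hz' hz
  · simpa [Measure.map_apply hΨ] using hl

lemma IsGraph.map_prod_right {ρ : Measure (ℝ × 𝓥)} (h : IsGraph ρ) (σ : Measure 𝓦)
    [IsFiniteMeasure σ] {Ψ : (ℝ × 𝓥) × 𝓦 → ℝ × 𝓤} (hΨ : Measurable Ψ)
    (H : ∀ f : 𝓥 → ℝ, Measurable f → ∃ k : 𝓤 → ℝ, Measurable k ∧
      ∀ z, z.1.1 = f z.1.2 → (Ψ z).1 = k (Ψ z).2) :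
    IsGraph ((ρ.prod σ).map Ψ) := by
  obtain ⟨ι, _, f, ℓ, m, hf, rfl, hm, hk, hl⟩ := h
  choose k hkm hkf using fun i => H (f i) (hf i)
  refine ⟨ι, inferInstance, k, ℓ, fun i => ((m i).prod σ).map Ψ, hkm, ?_, fun i => ?_, hk, ?_⟩
  · rw [Measure.prod_sum_left, Measure.map_sum hΨ.aemeasurable]
  · refine (ae_map_iff hΨ.aemeasurable (p := fun z => z.1 = k i z.2)
      (measurableSet_eq_fun measurable_fst ((hkm i).comp measurable_snd))).2 ?_
    filter_upwards [Measure.quasiMeasurePreserving_fst.ae (hm i)] with z hz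
    exact hkf i z hz
  · have h1 (i : ι) : (((m i).prod σ).map Ψ) Set.univ * ℓ i =
        m i Set.univ * ℓ i * σ Set.univ := by
      rw [Measure.map_apply hΨ MeasurableSet.univ, Set.preimage_univ, ← Set.univ_prod_univ,
        Measure.prod_prod]
      ring
    simp_rw [h1]
    rw [ENNReal.tsum_mul_right]
    exact ENNReal.mul_ne_top hl (measure_ne_top _ _)

/-- The image of a product of graph parts, when the new variable is a function of the new side
information on each pair of graphs. -/
lemma IsGraph.map_prod {ρ : Measure (ℝ × 𝓥)} {ρ' : Measure (ℝ × 𝓦)} [IsFiniteMeasure ρ]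
    [IsFiniteMeasure ρ'] (h : IsGraph ρ) (h' : IsGraph ρ') {Ψ : (ℝ × 𝓥) × (ℝ × 𝓦) → ℝ × 𝓤}
    (hΨ : Measurable Ψ)
    (H : ∀ (f : 𝓥 → ℝ) (f' : 𝓦 → ℝ), Measurable f → Measurable f' → ∃ k : 𝓤 → ℝ, Measurable k ∧
      ∀ z, z.1.1 = f z.1.2 → z.2.1 = f' z.2.2 → (Ψ z).1 = k (Ψ z).2) :
    IsGraph ((ρ.prod ρ').map Ψ) := by
  obtain ⟨ι, _, f, ℓ, m, hf, rfl, hm, hk, hl⟩ := h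
  obtain ⟨ι', _, f', ℓ', m', hf', rfl, hm', hk', hl'⟩ := h'
  have hfin (i) : IsFiniteMeasure (m i) := isFiniteMeasure_of_le _ (Measure.le_sum m i)
  have hfin' (i) : IsFiniteMeasure (m' i) := isFiniteMeasure_of_le _ (Measure.le_sum m' i)
  have htot : ∑' i, m i Set.univ ≠ ∞ := by
    rw [← Measure.sum_apply _ MeasurableSet.univ]
    exact measure_ne_top _ _
  have htot' : ∑' i, m' i Set.univ ≠ ∞ := by
    rw [← Measure.sum_apply _ MeasurableSet.univ]
    exact measure_ne_top _ _
  choose k hkm hkf using fun i i' => H (f i) (f' i') (hf i) (hf' i')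
  -- A pair of graphs is coded by concatenation: lengths add and Kraft sums multiply. The mean
  -- length stays finite because both measures are finite.
  refine ⟨ι × ι', inferInstance, fun p => k p.1 p.2, fun p => ℓ p.1 + ℓ' p.2,
    fun p => ((m p.1).prod (m' p.2)).map Ψ, fun p => hkm _ _, ?_, fun p => ?_, ?_, ?_⟩
  · rw [Measure.prod_sum, Measure.map_sum hΨ.aemeasurable]
  · refine (ae_map_iff hΨ.aemeasurable (p := fun z => z.1 = k p.1 p.2 z.2)
      (measurableSet_eq_fun measurable_fst ((hkm _ _).comp measurable_snd))).2 ?_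
    filter_upwards [Measure.quasiMeasurePreserving_fst.ae (hm p.1),
      Measure.quasiMeasurePreserving_snd.ae (hm' p.2)] with z hz hz'
    exact hkf _ _ z hz hz'
  · have h1 (p : ι × ι') : ENNReal.ofReal (Real.exp (-((ℓ p.1 + ℓ' p.2 : ℝ≥0) : ℝ))) =
        ENNReal.ofReal (Real.exp (-(ℓ p.1 : ℝ))) * ENNReal.ofReal (Real.exp (-(ℓ' p.2 : ℝ))) := by
      rw [← ENNReal.ofReal_mul (Real.exp_pos _).le, ← Real.exp_add]
      push_cast
      ring_nf
    simp_rw [h1]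
    rw [ENNReal.tsum_prod (f := fun i i' => ENNReal.ofReal (Real.exp (-(ℓ i : ℝ))) *
      ENNReal.ofReal (Real.exp (-(ℓ' i' : ℝ))))]
    simp_rw [ENNReal.tsum_mul_left, ENNReal.tsum_mul_right]
    exact ENNReal.mul_ne_top hk hk'
  · have h1 (p : ι × ι') : (((m p.1).prod (m' p.2)).map Ψ) Set.univ * ((ℓ p.1 + ℓ' p.2 : ℝ≥0)) =
        m p.1 Set.univ * ℓ p.1 * m' p.2 Set.univ + m p.1 Set.univ * (m' p.2 Set.univ * ℓ' p.2) := by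
      rw [Measure.map_apply hΨ MeasurableSet.univ, Set.preimage_univ, ← Set.univ_prod_univ,
        Measure.prod_prod]
      push_cast
      ring
    simp_rw [h1]
    rw [ENNReal.tsum_add,
      ENNReal.tsum_prod (f := fun i i' => m i Set.univ * ℓ i * m' i' Set.univ),
      ENNReal.tsum_prod (f := fun i i' => m i Set.univ * (m' i' Set.univ * ℓ' i'))]
    simp_rw [ENNReal.tsum_mul_left, ENNReal.tsum_mul_right]
    exact ENNReal.add_ne_top.2 ⟨ENNReal.mul_ne_top hl htot', ENNReal.mul_ne_top htot hl'⟩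

/-! ### Erasure pairs: relabelling and the two one-step transforms -/

lemma IsErasurePair.mem_Icc {μ : Measure (ℝ × 𝓥)} [IsProbabilityMeasure μ] {d : ℝ}
    (h : IsErasurePair μ d) : d ∈ Set.Icc (0 : ℝ) 1 := by
  obtain ⟨-, ρ₀, ρ₁, hμ, -, -, rfl⟩ := h
  refine ⟨measureReal_nonneg, ?_⟩
  have hle : ρ₁ ≤ μ := by
    rw [hμ]
    exact Measure.le_add_left le_rfl
  rw [← probReal_univ (μ := μ)]
  exact ENNReal.toReal_mono (measure_ne_top _ _) (hle _)

/-- The left inverse serves the graph part, which must recover the old side information. Asking for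
it only almost everywhere allows almost surely constant components to be dropped. -/
lemma IsErasurePair.map_snd {μ : Measure (ℝ × 𝓥)} {d : ℝ} (h : IsErasurePair μ d) {g : 𝓥 → 𝓦}
    (hg : Measurable g) {g' : 𝓦 → 𝓥} (hg' : Measurable g') (hgg' : ∀ᵐ z ∂μ, g' (g z.2) = z.2) :
    IsErasurePair (μ.map fun z => (z.1, g z.2)) d := by
  obtain ⟨hint, ρ₀, ρ₁, rfl, h₀, h₁, rfl⟩ := h
  have hm : Measurable fun z : ℝ × 𝓥 => (z.1, g z.2) := by fun_prop
  refine ⟨?_, _, _, Measure.map_add _ _ hm, h₀.map hm fun f hf => ?_, h₁.map_snd hg, ?_⟩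
  · rw [integrable_map_measure (by fun_prop) hm.aemeasurable]
    exact hint
  · refine ⟨f ∘ g', hf.comp hg', ?_⟩
    filter_upwards [(ae_add_measure_iff.1 hgg').1] with z hz hz'
    simp only [Function.comp_apply, hz, hz']
  · rw [map_measureReal_apply hm MeasurableSet.univ, Set.preimage_univ]

section OneStep

variable {μ : Measure (ℝ × 𝓥)} {μ' : Measure (ℝ × 𝓦)} [IsProbabilityMeasure μ]
  [IsProbabilityMeasure μ'] {α β : ℝ}

lemma real_map_prod_univ {A B C : Type*} [MeasurableSpace A] [MeasurableSpace B]
    [MeasurableSpace C] (ρ : Measure A) (σ : Measure B) [SFinite σ] {Ψ : A × B → C}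
    (hΨ : Measurable Ψ) :
    ((ρ.prod σ).map Ψ).real Set.univ = ρ.real Set.univ * σ.real Set.univ := by
  rw [map_measureReal_apply hΨ MeasurableSet.univ, Set.preimage_univ, ← Set.univ_prod_univ,
    measureReal_prod_prod]

/-- The sum, given both side informations. -/
lemma IsErasurePair.add (h : IsErasurePair μ α) (h' : IsErasurePair μ' β) :
    IsErasurePair ((μ.prod μ').map fun z => (z.1.1 + z.2.1, (z.1.2, z.2.2)))
      (α + β - α * β) := by
  obtain ⟨hint, ρ₀, ρ₁, hμ, h₀, h₁, rfl⟩ := h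
  obtain ⟨hint', ρ₀', ρ₁', hμ', h₀', h₁', rfl⟩ := h'
  have e₀ : IsFiniteMeasure ρ₀ := isFiniteMeasure_of_le μ (hμ ▸ Measure.le_add_right le_rfl)
  have e₁ : IsFiniteMeasure ρ₁ := isFiniteMeasure_of_le μ (hμ ▸ Measure.le_add_left le_rfl)
  have e₀' : IsFiniteMeasure ρ₀' := isFiniteMeasure_of_le μ' (hμ' ▸ Measure.le_add_right le_rfl)
  have e₁' : IsFiniteMeasure ρ₁' := isFiniteMeasure_of_le μ' (hμ' ▸ Measure.le_add_left le_rfl)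
  set Φ : (ℝ × 𝓥) × (ℝ × 𝓦) → ℝ × (𝓥 × 𝓦) := fun z => (z.1.1 + z.2.1, (z.1.2, z.2.2))
  have hΦ : Measurable Φ := by fun_prop
  -- One variable with a conditional density is enough: the other acts as an independent shift. Only
  -- the product of the two graph parts stays on graphs.
  refine ⟨?_, (ρ₀.prod ρ₀').map Φ, (ρ₁.prod μ').map Φ + (ρ₀.prod ρ₁').map Φ, ?_, ?_,
    IsAC.add ?_ ?_, ?_⟩
  · rw [integrable_map_measure (by fun_prop) hΦ.aemeasurable]
    exact (hint.comp_fst μ').add (hint'.comp_snd μ)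
  · rw [← Measure.map_add _ _ hΦ, ← Measure.map_add _ _ hΦ]
    congr 1
    rw [add_left_comm, ← Measure.prod_add, ← hμ', add_comm, ← Measure.add_prod, ← hμ]
  · exact h₀.map_prod h₀' hΦ fun f f' hf hf' => ⟨fun u => f u.1 + f' u.2, by fun_prop,
      fun z hz hz' => by simp only [Φ, hz, hz']⟩
  · exact h₁.map_prod μ' (c := fun u => u.2.1) (by fun_prop) (g := fun u => (u.1, u.2.2))
      (by fun_prop)
  · have := h₁'.map_prod ρ₀ (c := fun u => u.2.1) (by fun_prop) (g := fun u => (u.2.2, u.1))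
      (by fun_prop)
    rw [← Measure.prod_swap, Measure.map_map hΦ measurable_swap]
    convert this using 2
    ext z <;> simp [Φ, add_comm]
  · have hsum : ρ₀.real Set.univ + ρ₁.real Set.univ = 1 := by
      rw [← measureReal_add_apply, ← hμ, probReal_univ (μ := μ)]
    rw [measureReal_add_apply, real_map_prod_univ _ _ hΦ, real_map_prod_univ _ _ hΦ,
      probReal_univ (μ := μ')]
    linear_combination (ρ₁'.real Set.univ) * hsum

/-- The difference, given the sum and both side informations. -/
lemma IsErasurePair.sub (h : IsErasurePair μ α) (h' : IsErasurePair μ' β) :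
    IsErasurePair ((μ.prod μ').map fun z => (z.1.1 - z.2.1, (z.1.1 + z.2.1, (z.1.2, z.2.2))))
      (α * β) := by
  obtain ⟨hint, ρ₀, ρ₁, hμ, h₀, h₁, rfl⟩ := h
  obtain ⟨hint', ρ₀', ρ₁', hμ', h₀', h₁', rfl⟩ := h'
  have e₀ : IsFiniteMeasure ρ₀ := isFiniteMeasure_of_le μ (hμ ▸ Measure.le_add_right le_rfl)
  have e₁ : IsFiniteMeasure ρ₁ := isFiniteMeasure_of_le μ (hμ ▸ Measure.le_add_left le_rfl)
  have e₀' : IsFiniteMeasure ρ₀' := isFiniteMeasure_of_le μ' (hμ' ▸ Measure.le_add_right le_rfl)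
  have e₁' : IsFiniteMeasure ρ₁' := isFiniteMeasure_of_le μ' (hμ' ▸ Measure.le_add_left le_rfl)
  set Φ : (ℝ × 𝓥) × (ℝ × 𝓦) → ℝ × (ℝ × (𝓥 × 𝓦)) :=
    fun z => (z.1.1 - z.2.1, (z.1.1 + z.2.1, (z.1.2, z.2.2))) with hΦdef
  have hΦ : Measurable Φ := by fun_prop
  -- Given s = x + x', knowing either variable determines the difference, as 2x - s or as s - 2x'.
  -- Hence only the product of the two density parts survives.
  refine ⟨?_, (ρ₀.prod μ').map Φ + (ρ₁.prod ρ₀').map Φ, (ρ₁.prod ρ₁').map Φ, ?_, ?_,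
    h₁.map_sub_add h₁', real_map_prod_univ _ _ hΦ⟩
  · rw [integrable_map_measure (by fun_prop) hΦ.aemeasurable]
    exact (hint.comp_fst μ').sub (hint'.comp_snd μ)
  · rw [← Measure.map_add _ _ hΦ, ← Measure.map_add _ _ hΦ]
    congr 1
    rw [add_assoc, ← Measure.prod_add, ← hμ', ← Measure.add_prod, ← hμ]
  · refine IsGraph.add (h₀.map_prod_right μ' hΦ fun f hf =>
      ⟨fun u => 2 * f u.2.1 - u.1, by fun_prop, fun z hz => ?_⟩) ?_
    · simp only [Φ, ← hz]
      ring
    · rw [← Measure.prod_swap, Measure.map_map hΦ measurable_swap]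
      refine h₀'.map_prod_right ρ₁ (hΦ.comp measurable_swap) fun f hf =>
        ⟨fun u => u.1 - 2 * f u.2.2, by fun_prop, fun z hz => ?_⟩
      simp only [Φ, Function.comp_apply, Prod.fst_swap, Prod.snd_swap, ← hz]
      ring

end OneStep

/-! ### Linear images of independent nonsingular variables -/

/-- The law of `g • v` for a standard Gaussian `g`. -/
def lineLaw (v : ℝ × ℝ) : Measure (ℝ × ℝ) := (gaussianReal 0 1).map fun e => e • v

instance (v : ℝ × ℝ) : IsProbabilityMeasure (lineLaw v) :=
  Measure.isProbabilityMeasure_map (by fun_prop)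

/-- The three shapes of a Gaussian law on the plane, up to equivalence and with regard to the
conditional behaviour of the first coordinate given the second one. -/
def IsBasic (κ : Measure (ℝ × ℝ)) : Prop :=
  κ = Measure.dirac 0 ∨
  (∃ (c : ℝ) (ξ : Measure ℝ), SFinite ξ ∧ ξ ≪ volume ∧ κ = ξ.map fun x => (c * x, x)) ∨
  IsAC κ

lemma map_mul_left_absolutelyContinuous {ξ : Measure ℝ} (h : ξ ≪ volume) {a : ℝ} (ha : a ≠ 0) :
    ξ.map (fun x => a * x) ≪ volume := by
  refine (h.map (by fun_prop)).trans ?_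
  rw [Real.map_volume_mul_left ha]
  exact Measure.smul_absolutelyContinuous

lemma gaussianReal_absolutelyContinuous_volume : gaussianReal 0 1 ≪ volume :=
  gaussianReal_absolutelyContinuous 0 one_ne_zero

/-- A horizontal line leaves the first coordinate free given the second, so it counts as a density.
Any other line is a graph over the second coordinate. -/
lemma isBasic_lineLaw (v : ℝ × ℝ) : IsBasic (lineLaw v) := by
  by_cases hb : v.2 = 0
  · by_cases ha : v.1 = 0
    · left
      have : v = 0 := Prod.ext ha hb
      simp [lineLaw, this, Measure.map_const]
    · right; right
      refine ⟨Measure.dirac 0, inferInstance, ?_⟩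
      have h := (map_mul_left_absolutelyContinuous gaussianReal_absolutelyContinuous_volume ha).prod
        (Measure.AbsolutelyContinuous.refl (Measure.dirac (0 : ℝ)))
      rw [Measure.prod_dirac, Measure.map_map (by fun_prop) (by fun_prop)] at h
      convert h using 1
      rw [lineLaw]
      congr 1
      ext e <;> simp [hb, mul_comm]
  · right; left
    refine ⟨v.1 / v.2, (gaussianReal 0 1).map fun x => v.2 * x, inferInstance,
      map_mul_left_absolutelyContinuous gaussianReal_absolutelyContinuous_volume hb, ?_⟩
    rw [lineLaw, Measure.map_map (by fun_prop) (by fun_prop)]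
    congr 1
    ext e
    · simp
      field_simp
    · simp [mul_comm]

lemma IsAC.map_fst_absolutelyContinuous {𝓥 : Type*} [MeasurableSpace 𝓥] {ρ : Measure (ℝ × 𝓥)}
    (h : IsAC ρ) : ρ.map Prod.fst ≪ volume := by
  obtain ⟨ν, hν, h⟩ := h
  exact (h.map measurable_fst).trans Measure.quasiMeasurePreserving_fst.absolutelyContinuous

/-- A new direction turns a point into a line or leaves it a point. It keeps a non-horizontal line
when parallel to it and otherwise fills the plane; a conditional density is never lost. -/
lemma IsBasic.conv_lineLaw {κ : Measure (ℝ × ℝ)} [SFinite κ] (h : IsBasic κ) (v : ℝ × ℝ) :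
    IsBasic (κ ∗ lineLaw v) := by
  rcases h with rfl | ⟨c, ξ, _, hξ, rfl⟩ | h
  · rw [Measure.dirac_zero_conv]
    exact isBasic_lineLaw v
  · have hconv : (ξ.map fun x => (c * x, x)) ∗ lineLaw v =
        (ξ.prod (gaussianReal 0 1)).map fun p => (c * p.1 + v.1 * p.2, 1 * p.1 + v.2 * p.2) := by
      rw [Measure.conv, lineLaw, Measure.map_prod_map _ _ (by fun_prop) (by fun_prop),
        Measure.map_map (by fun_prop) (by fun_prop)]
      congr 1
      ext p <;> simp [mul_comm]
    rw [hconv]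
    right
    -- The determinant of the directions (c, 1) and v; it vanishes exactly when v is parallel to the
    -- line.
    by_cases hv : c * v.2 - v.1 * 1 = 0
    · left
      have hAC : IsAC (ξ.prod (gaussianReal 0 1)) :=
        ⟨_, inferInstance, hξ.prod Measure.AbsolutelyContinuous.rfl⟩
      have h1 := (hAC.shear (c := fun e => v.2 * e) (by fun_prop)).map_fst_absolutelyContinuous
      rw [Measure.map_map (by fun_prop) (by fun_prop)] at h1
      refine ⟨c, _, inferInstance, h1, ?_⟩
      rw [Measure.map_map (by fun_prop) (by fun_prop)]
      congr 1
      ext p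
      · simp only [Function.comp_apply]
        linear_combination -p.2 * hv
      · simp
    · right
      exact ⟨_, inferInstance, ((hξ.prod gaussianReal_absolutelyContinuous_volume).map
        (by fun_prop)).trans (quasiMeasurePreserving_linear_two hv).absolutelyContinuous⟩
  · right; right
    exact h.map_prod (lineLaw v) (c := fun u => u.2.1) (by fun_prop) (g := fun u => u.1 + u.2.2)
      (by fun_prop)

/-- A countable superposition, with finite mean code length, of measures which are absolutely
continuous with respect to translates of `κ`. -/
def IsMixture (κ m : Measure (ℝ × ℝ)) : Prop :=
  ∃ (ι : Type) (_ : Countable ι) (t : ι → ℝ × ℝ) (ℓ : ι → ℝ≥0) (μ : ι → Measure (ℝ × ℝ)),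
    m = Measure.sum μ ∧ (∀ i, μ i ≪ Measure.dirac (t i) ∗ κ) ∧
    ∑' i, ENNReal.ofReal (Real.exp (-(ℓ i : ℝ))) ≠ ∞ ∧ ∑' i, μ i Set.univ * ℓ i ≠ ∞

/-- All components live on translates of the same `κ` and so share its shape. A translated point or
line is again a graph, and the code of the mixture becomes the code of the graphs. -/
lemma IsBasic.isGraph_or_isAC {κ m : Measure (ℝ × ℝ)} [SFinite κ] (h : IsBasic κ)
    (hm : IsMixture κ m) :
    IsGraph m ∨ IsAC m := by
  obtain ⟨ι, _, t, ℓ, μ, rfl, hμ, hk, hl⟩ := hm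
  rcases h with rfl | ⟨c, ξ, _, hξ, rfl⟩ | h
  · left
    refine ⟨ι, inferInstance, fun i _ => (t i).1, ℓ, μ, fun i => measurable_const, rfl,
      fun i => (hμ i).ae_le ?_, hk, hl⟩
    change ∀ᵐ z ∂(Measure.dirac (t i) ∗ Measure.dirac 0), z.1 = (t i).1
    rw [Measure.conv_dirac_zero, ae_dirac_iff (measurableSet_eq_fun (by fun_prop) (by fun_prop))]
  · left
    refine ⟨ι, inferInstance, fun i x => c * (x - (t i).2) + (t i).1, ℓ, μ, fun i => by fun_prop,
      rfl, fun i => (hμ i).ae_le ?_, hk, hl⟩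
    change ∀ᵐ z ∂(Measure.dirac (t i) ∗ ξ.map fun x => (c * x, x)),
      z.1 = c * (z.2 - (t i).2) + (t i).1
    rw [Measure.dirac_conv, Measure.map_map (by fun_prop) (by fun_prop),
      ae_map_iff (by fun_prop) (measurableSet_eq_fun (by fun_prop) (by fun_prop))]
    refine ae_of_all _ fun x => ?_
    simp
    ring
  · right
    refine IsAC.sum fun i => ?_
    have h1 := (h.shear (c := fun _ => (t i).1) (by fun_prop)).map_snd
      (g := fun x => (t i).2 + x) (by fun_prop)
    refine h1.mono ?_
    have h2 := hμ i
    rw [Measure.dirac_conv] at h2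
    rw [Measure.map_map (by fun_prop) (by fun_prop)]
    convert h2 using 2
    ext z <;> simp [add_comm]

/-- A discrete measure with finite mean code length. -/
def IsDiscrete {S : Type*} [MeasurableSpace S] (η : Measure S) : Prop :=
  ∃ (ι : Type) (_ : Countable ι) (t : ι → S) (ℓ : ι → ℝ≥0) (w : ι → ℝ≥0∞),
    η = Measure.sum (fun i => w i • Measure.dirac (t i)) ∧
    ∑' i, ENNReal.ofReal (Real.exp (-(ℓ i : ℝ))) ≠ ∞ ∧ ∑' i, w i * ℓ i ≠ ∞

lemma IsDiscrete.map {S T : Type*} [MeasurableSpace S] [MeasurableSpace T] {η : Measure S}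
    (h : IsDiscrete η) {f : S → T} (hf : Measurable f) : IsDiscrete (η.map f) := by
  obtain ⟨ι, _, t, ℓ, w, rfl, hk, hl⟩ := h
  refine ⟨ι, inferInstance, fun i => f (t i), ℓ, w, ?_, hk, hl⟩
  rw [Measure.map_sum hf.aemeasurable]
  simp_rw [Measure.map_smul, Measure.map_dirac' hf]

/-- A discrete summand adds translates but no direction, so `κ` is unchanged; translates and code
lengths add. -/
lemma IsMixture.conv_isDiscrete {κ m η : Measure (ℝ × ℝ)} [SFinite κ] [IsFiniteMeasure m]
    [IsFiniteMeasure η] (hm : IsMixture κ m) (hη : IsDiscrete η) : IsMixture κ (m ∗ η) := by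
  obtain ⟨ι, _, t, ℓ, μ, rfl, hμ, hk, hl⟩ := hm
  obtain ⟨ι', _, t', ℓ', w, rfl, hk', hl'⟩ := hη
  have hfin (i) : IsFiniteMeasure (μ i) := isFiniteMeasure_of_le _ (Measure.le_sum μ i)
  have hfin' (i) : IsFiniteMeasure (w i • Measure.dirac (t' i)) :=
    isFiniteMeasure_of_le _ (Measure.le_sum (fun i => w i • Measure.dirac (t' i)) i)
  have htot : ∑' i, μ i Set.univ ≠ ∞ := by
    rw [← Measure.sum_apply _ MeasurableSet.univ]
    exact measure_ne_top _ _
  have htot' : ∑' i, w i ≠ ∞ := by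
    have := measure_ne_top (Measure.sum fun i => w i • Measure.dirac (t' i)) Set.univ
    rw [Measure.sum_apply _ MeasurableSet.univ] at this
    simpa using this
  have hadd : Measurable fun z : (ℝ × ℝ) × (ℝ × ℝ) => z.1 + z.2 := by fun_prop
  refine ⟨ι × ι', inferInstance, fun p => t p.1 + t' p.2, fun p => ℓ p.1 + ℓ' p.2,
    fun p => μ p.1 ∗ (w p.2 • Measure.dirac (t' p.2)), ?_, fun p => ?_, ?_, ?_⟩
  · rw [Measure.conv, Measure.prod_sum, Measure.map_sum hadd.aemeasurable]
    rfl
  · have h1 : Measure.dirac (t p.1 + t' p.2) ∗ κ =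
        (Measure.dirac (t p.1) ∗ κ) ∗ Measure.dirac (t' p.2) := by
      rw [Measure.conv_assoc, Measure.conv_comm κ, ← Measure.conv_assoc, Measure.dirac_conv_dirac]
    rw [h1]
    exact ((hμ p.1).prod Measure.smul_absolutelyContinuous).map hadd
  · have h1 (p : ι × ι') : ENNReal.ofReal (Real.exp (-((ℓ p.1 + ℓ' p.2 : ℝ≥0) : ℝ))) =
        ENNReal.ofReal (Real.exp (-(ℓ p.1 : ℝ))) * ENNReal.ofReal (Real.exp (-(ℓ' p.2 : ℝ))) := by
      rw [← ENNReal.ofReal_mul (Real.exp_pos _).le, ← Real.exp_add]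
      push_cast
      ring_nf
    simp_rw [h1]
    rw [ENNReal.tsum_prod (f := fun i i' => ENNReal.ofReal (Real.exp (-(ℓ i : ℝ))) *
      ENNReal.ofReal (Real.exp (-(ℓ' i' : ℝ))))]
    simp_rw [ENNReal.tsum_mul_left, ENNReal.tsum_mul_right]
    exact ENNReal.mul_ne_top hk hk'
  · have h1 (p : ι × ι') :
        (μ p.1 ∗ (w p.2 • Measure.dirac (t' p.2))) Set.univ * ((ℓ p.1 + ℓ' p.2 : ℝ≥0)) =
        μ p.1 Set.univ * ℓ p.1 * w p.2 + μ p.1 Set.univ * (w p.2 * ℓ' p.2) := by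
      rw [Measure.conv, Measure.map_apply hadd MeasurableSet.univ, Set.preimage_univ,
        ← Set.univ_prod_univ, Measure.prod_prod]
      simp
      ring
    simp_rw [h1]
    rw [ENNReal.tsum_add,
      ENNReal.tsum_prod (f := fun i i' => μ i Set.univ * ℓ i * w i'),
      ENNReal.tsum_prod (f := fun i i' => μ i Set.univ * (w i' * ℓ' i'))]
    simp_rw [ENNReal.tsum_mul_left, ENNReal.tsum_mul_right]
    exact ENNReal.add_ne_top.2 ⟨ENNReal.mul_ne_top hl htot', ENNReal.mul_ne_top htot hl'⟩

/-- A continuous summand adds a direction to `κ` and leaves the translates and their code alone. -/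
lemma IsMixture.conv_of_absolutelyContinuous {κ m η : Measure (ℝ × ℝ)} [SFinite κ]
    [IsFiniteMeasure η] (hm : IsMixture κ m) {v : ℝ × ℝ} (hη : η ≪ lineLaw v) :
    IsMixture (κ ∗ lineLaw v) (m ∗ η) := by
  obtain ⟨ι, _, t, ℓ, μ, rfl, hμ, hk, hl⟩ := hm
  have hadd : Measurable fun z : (ℝ × ℝ) × (ℝ × ℝ) => z.1 + z.2 := by fun_prop
  refine ⟨ι, inferInstance, t, ℓ, fun i => μ i ∗ η, ?_, fun i => ?_, hk, ?_⟩
  · rw [Measure.conv, Measure.prod_sum_left, Measure.map_sum hadd.aemeasurable]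
    rfl
  · rw [← Measure.conv_assoc]
    exact ((hμ i).prod hη).map hadd
  · have h1 (i : ι) : (μ i ∗ η) Set.univ * ℓ i = μ i Set.univ * ℓ i * η Set.univ := by
      rw [Measure.conv, Measure.map_apply hadd MeasurableSet.univ, Set.preimage_univ,
        ← Set.univ_prod_univ, Measure.prod_prod]
      ring
    simp_rw [h1]
    rw [ENNReal.tsum_mul_right]
    exact ENNReal.mul_ne_top hl (measure_ne_top _ _)

/-- The Shannon code, of length -log p{s}, has Kraft sum 1 and mean length the entropy in nats. -/
lemma isDiscrete_of_entropy_ne_top (p : Measure ℝ) [IsProbabilityMeasure p] {S : Set ℝ}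
    (hS : S.Countable) (hp : p Sᶜ = 0) (hent : entropy p ≠ ∞) (b : ℝ≥0) : IsDiscrete (b • p) := by
  -- Points of zero mass must go: as `Real.log 0 = 0`, each would receive length 0 and add 1 to the
  -- Kraft sum.
  set T : Set ℝ := {s ∈ S | p {s} ≠ 0} with hT
  have hTc : T.Countable := hS.mono (Set.sep_subset _ _)
  have : Countable T := hTc.to_subtype
  have hpT : p Tᶜ = 0 := by
    have h1 : Tᶜ ⊆ Sᶜ ∪ ⋃ s ∈ {s ∈ S | p {s} = 0}, {s} := by
      intro x hx
      by_cases hxS : x ∈ S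
      · right
        simp only [Set.mem_iUnion, Set.mem_singleton_iff, exists_prop, exists_eq_right']
        refine ⟨hxS, ?_⟩
        by_contra h
        exact hx ⟨hxS, h⟩
      · exact Or.inl hxS
    refine measure_mono_null h1 (measure_union_null hp ?_)
    exact (measure_biUnion_null_iff (hS.mono (Set.sep_subset _ _))).2 fun s hs => hs.2
  have hsum (A : Set ℝ) (hA : MeasurableSet A) :
      p A = ∑' s : T, p {(s : ℝ)} * Measure.dirac (s : ℝ) A := by
    have h1 : p A = p (⋃ s : T, {(s : ℝ)} ∩ A) := by
      rw [← Set.iUnion_inter]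
      refine (measure_inter_conull' ?_).symm.trans (by rw [Set.inter_comm])
      refine measure_mono_null ?_ hpT
      rintro x ⟨-, hx⟩ hxT
      exact hx (Set.mem_iUnion.2 ⟨⟨x, hxT⟩, rfl⟩)
    rw [h1, measure_iUnion]
    · refine tsum_congr fun s => ?_
      by_cases hs : (s : ℝ) ∈ A
      · rw [Set.inter_eq_left.2 (by simpa using hs)]
        simp [hs]
      · have : {(s : ℝ)} ∩ A = ∅ := by simpa using hs
        simp [this, hs, hA]
    · intro s s' hss
      refine Set.disjoint_of_subset Set.inter_subset_left Set.inter_subset_left ?_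
      simpa [Subtype.ext_iff] using hss
    · exact fun s => (measurableSet_singleton _).inter hA
  have hpos (s : T) : 0 < p.real {(s : ℝ)} := by
    rw [measureReal_def]
    exact ENNReal.toReal_pos s.2.2 (measure_ne_top _ _)
  have hlog (s : T) : 0 ≤ -Real.log (p.real {(s : ℝ)}) := by
    have := Real.log_nonpos (hpos s).le measureReal_le_one
    linarith
  have hlog2 := Real.log_pos one_lt_two
  set ℓ : T → ℝ≥0 := fun s => (-Real.log (p.real {(s : ℝ)})).toNNReal
  have hℓ (s : T) : (ℓ s : ℝ) = -Real.log (p.real {(s : ℝ)}) := Real.coe_toNNReal _ (hlog s)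
  refine ⟨T, inferInstance, Subtype.val, ℓ, fun s => b * p {(s : ℝ)}, ?_, ?_, ?_⟩
  · ext A hA
    rw [Measure.sum_apply _ hA, Measure.smul_apply, hsum A hA, ENNReal.smul_def, smul_eq_mul,
      ← ENNReal.tsum_mul_left]
    refine tsum_congr fun s => ?_
    rw [Measure.smul_apply, smul_eq_mul, mul_assoc]
  · have h1 : ∑' s : T, ENNReal.ofReal (Real.exp (-(-Real.log (p.real {(s : ℝ)})))) =
        p Set.univ := by
      rw [hsum _ MeasurableSet.univ]
      refine tsum_congr fun s => ?_
      rw [neg_neg, Real.exp_log (hpos s), ofReal_measureReal]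
      simp
    simp_rw [hℓ]
    exact ne_of_eq_of_ne h1 (measure_ne_top _ _)
  · have h1 : ∑' s : T, p {(s : ℝ)} * ℓ s ≤
        ENNReal.ofReal (Real.log 2) * entropy p := by
      rw [entropy, ← ENNReal.tsum_mul_left]
      refine le_trans (le_of_eq (tsum_congr fun s => ?_)) (ENNReal.tsum_comp_le_tsum_of_injective
        Subtype.val_injective fun s : ℝ => ENNReal.ofReal (Real.log 2) *
          ENNReal.ofReal (Real.negMulLog (p.real {s}) / Real.log 2))
      rw [← ENNReal.ofReal_mul hlog2.le, mul_div_cancel₀ _ hlog2.ne', Real.negMulLog,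
        ← ofReal_measureReal, ← ENNReal.ofReal_coe_nnreal, ← ENNReal.ofReal_mul measureReal_nonneg,
        hℓ, neg_mul, mul_neg]
    simp_rw [mul_assoc]
    rw [ENNReal.tsum_mul_left]
    exact ENNReal.mul_ne_top ENNReal.coe_ne_top
      (ne_top_of_le_ne_top (ENNReal.mul_ne_top ENNReal.ofReal_ne_top hent) h1)

/-- The law of `E • v` for a nonsingular `E`. -/
lemma IsNonsingularLaw.exists_map_smul_eq_add {μ : Measure ℝ} (h : IsNonsingularLaw μ)
    (v : ℝ × ℝ) : ∃ η₁ η₀ : Measure (ℝ × ℝ), IsFiniteMeasure η₁ ∧ IsFiniteMeasure η₀ ∧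
      (μ.map fun e => e • v) = η₁ + η₀ ∧ η₁ ≪ lineLaw v ∧ IsDiscrete η₀ := by
  obtain ⟨⟨a, b, pc, pd, -, _, _, hpc, ⟨S, hS, hpd⟩, hent, rfl⟩, -⟩ := h
  have hm : Measurable fun e : ℝ => e • v := by fun_prop
  refine ⟨(a • pc).map fun e => e • v, (b • pd).map fun e => e • v, inferInstance, inferInstance,
    Measure.map_add _ _ hm, ?_, (isDiscrete_of_entropy_ne_top pd hS hpd hent b).map hm⟩
  exact (Measure.smul_absolutelyContinuous.trans
    (hpc.trans (gaussianReal_absolutelyContinuous' 0 one_ne_zero))).map hm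

section Linear

variable {Ω : Type*} [MeasurableSpace Ω] {P : Measure Ω} [IsProbabilityMeasure P] {k : ℕ}
  {E : Fin k → Ω → ℝ}

lemma measurable_sum_smul (hE : ∀ j, Measurable (E j)) (v : Fin k → ℝ × ℝ) (s : Finset (Fin k)) :
    Measurable (∑ j ∈ s, fun ω => E j ω • v j) := by
  have := Finset.measurable_fun_sum s fun j _ => (hE j).smul_const (v j)
  convert this using 1
  ext ω : 1
  rw [Finset.sum_apply]

/-- Splitting every law expands the convolution into 2^|s| terms. The summands taken continuous in a
term fix its `κ`, so each term is wholly a graph part or wholly a density part. Hence `κ` and `m`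
vary in the induction, each step of which branches in two. -/
lemma exists_graph_add_ac (hE : ∀ j, Measurable (E j)) (hindep : iIndepFun E P)
    (hns : ∀ j, IsNonsingularLaw (P.map (E j))) (v : Fin k → ℝ × ℝ) (s : Finset (Fin k))
    {κ m : Measure (ℝ × ℝ)} [SFinite κ] [IsFiniteMeasure m] (hκ : IsBasic κ) (hm : IsMixture κ m) :
    ∃ ρ₀ ρ₁, m ∗ P.map (∑ j ∈ s, fun ω => E j ω • v j) = ρ₀ + ρ₁ ∧ IsGraph ρ₀ ∧ IsAC ρ₁ := by
  induction s using Finset.induction_on generalizing κ m with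
  | empty =>
    have h1 : P.map (∑ j ∈ (∅ : Finset (Fin k)), fun ω => E j ω • v j) = Measure.dirac 0 := by
      rw [Finset.sum_empty]
      exact (Measure.map_const P (0 : ℝ × ℝ)).trans (by simp)
    rw [h1, Measure.conv_dirac_zero]
    rcases hκ.isGraph_or_isAC hm with h | h
    · exact ⟨m, 0, by simp, h, isAC_zero⟩
    · exact ⟨0, m, by simp, isGraph_zero, h⟩
  | insert j s hj ih =>
    have hEm (j : Fin k) : Measurable fun ω => E j ω • v j := (hE j).smul_const _
    have hind : IndepFun (fun ω => E j ω • v j) (∑ j ∈ s, fun ω => E j ω • v j) P :=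
      ((hindep.comp (fun j e => e • v j) fun j => by fun_prop).indepFun_finsetSum_of_notMem
        hEm hj).symm
    have hconv : P.map (∑ j ∈ insert j s, fun ω => E j ω • v j) =
        P.map (fun ω => E j ω • v j) ∗ P.map (∑ j ∈ s, fun ω => E j ω • v j) := by
      rw [Finset.sum_insert hj]
      exact hind.map_add_eq_map_conv_map (hEm j) (measurable_sum_smul hE v s)
    obtain ⟨η₁, η₀, _, _, hη, h₁, h₀⟩ := (hns j).exists_map_smul_eq_add (v j)
    have hlaw : P.map (fun ω => E j ω • v j) = η₁ + η₀ := by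
      rw [← hη, Measure.map_map (by fun_prop) (hE j)]
      rfl
    obtain ⟨α₀, α₁, hα, hα₀, hα₁⟩ := ih (hκ.conv_lineLaw (v j)) (hm.conv_of_absolutelyContinuous h₁)
    obtain ⟨β₀, β₁, hβ, hβ₀, hβ₁⟩ := ih hκ (hm.conv_isDiscrete h₀)
    refine ⟨α₀ + β₀, α₁ + β₁, ?_, hα₀.add hβ₀, hα₁.add hβ₁⟩
    rw [hconv, ← Measure.conv_assoc, hlaw, Measure.conv_add, Measure.add_conv, hα, hβ]
    abel

/-- Two linear combinations of independent nonsingular variables form an erasure pair. -/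
theorem exists_isErasurePair_linear (hE : ∀ j, Measurable (E j)) (hindep : iIndepFun E P)
    (hns : ∀ j, IsNonsingularLaw (P.map (E j))) (v : Fin k → ℝ × ℝ) :
    ∃ d, IsErasurePair (P.map (∑ j, fun ω => E j ω • v j)) d := by
  have hmix : IsMixture (Measure.dirac 0) (Measure.dirac 0) := by
    refine ⟨Unit, inferInstance, fun _ => 0, fun _ => 0, fun _ => Measure.dirac 0, ?_, fun i => ?_,
      by simp, by simp⟩
    · simp
    · rw [Measure.conv_dirac_zero]
  obtain ⟨ρ₀, ρ₁, h, h₀, h₁⟩ := exists_graph_add_ac hE hindep hns v Finset.univ (Or.inl rfl) hmix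
  rw [Measure.dirac_zero_conv] at h
  refine ⟨_, ?_, ρ₀, ρ₁, h, h₀, h₁, rfl⟩
  rw [integrable_map_measure (by fun_prop) (measurable_sum_smul hE v _).aemeasurable]
  have hint (j : Fin k) : Integrable (E j) P := by
    have h2 := ((memLp_map_measure_iff (by fun_prop) (hE j).aemeasurable).1 (hns j).2)
    exact h2.integrable (by norm_num)
  have : Prod.fst ∘ (∑ j, fun ω => E j ω • v j) = fun ω => ∑ j, E j ω * (v j).1 := by
    ext ω
    simp [Prod.fst_sum]
  rw [this]
  exact integrable_finsetSum _ fun j _ => (hint j).mul_const _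

end Linear

/-! ### Recursive structure of the Hadamard transform -/

/-- The two halves of the index set of size `2 ^ (n + 1)`. -/
def halves (n : ℕ) : Fin (2 ^ n) ⊕ Fin (2 ^ n) ≃ Fin (2 ^ (n + 1)) :=
  finSumFinEquiv.trans (finCongr (by rw [pow_succ, mul_two]))

lemma halves_inl_val {n : ℕ} (i : Fin (2 ^ n)) : (halves n (Sum.inl i) : ℕ) = i := by
  simp [halves]

lemma halves_inr_val {n : ℕ} (i : Fin (2 ^ n)) : (halves n (Sum.inr i) : ℕ) = 2 ^ n + i := by
  simp [halves, add_comm]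

lemma hadamard_succ (n : ℕ) : hadamard (n + 1) = Matrix.reindex (halves n) (halves n)
    (Matrix.fromBlocks (hadamard n) (hadamard n) (hadamard n) (-hadamard n)) := rfl

lemma hadamard_succ_mulVec (n : ℕ) (y : Fin (2 ^ (n + 1)) → ℝ) (s : Fin (2 ^ n) ⊕ Fin (2 ^ n)) :
    (hadamard (n + 1) *ᵥ y) (halves n s) =
      Sum.elim (hadamard n *ᵥ fun j => y (halves n (Sum.inl j)) + y (halves n (Sum.inr j)))
        (hadamard n *ᵥ fun j => y (halves n (Sum.inl j)) - y (halves n (Sum.inr j))) s := by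
  rw [hadamard_succ, Matrix.reindex_apply, Matrix.submatrix_mulVec_equiv, Function.comp_apply,
    Equiv.symm_apply_apply, Equiv.symm_symm, Matrix.fromBlocks_mulVec]
  congr 1
  · rw [← Matrix.mulVec_add]
    rfl
  · rw [Matrix.neg_mulVec, ← sub_eq_add_neg, ← Matrix.mulVec_sub]
    rfl

/-- Conditioning on a Hadamard transform is therefore the same as conditioning on the vector itself,
with an explicit measurable inverse. -/
lemma hadamard_mulVec_hadamard_mulVec (n : ℕ) (y : Fin (2 ^ n) → ℝ) :
    hadamard n *ᵥ (hadamard n *ᵥ y) = (2 : ℝ) ^ n • y := by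
  induction n with
  | zero => simp [hadamard]
  | succ n ih =>
    ext i
    obtain ⟨s, rfl⟩ := (halves n).surjective i
    rw [hadamard_succ_mulVec]
    simp_rw [hadamard_succ_mulVec]
    set yp : Fin (2 ^ n) → ℝ := fun j => y (halves n (Sum.inl j)) + y (halves n (Sum.inr j)) with hp
    set ym : Fin (2 ^ n) → ℝ := fun j => y (halves n (Sum.inl j)) - y (halves n (Sum.inr j)) with hm
    rcases s with s | s
    · have h : (fun j => Sum.elim (hadamard n *ᵥ yp) (hadamard n *ᵥ ym) (Sum.inl j) +
          Sum.elim (hadamard n *ᵥ yp) (hadamard n *ᵥ ym) (Sum.inr j)) =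
          hadamard n *ᵥ ((2 : ℝ) • fun j => y (halves n (Sum.inl j))) := by
        change (hadamard n *ᵥ _) + (hadamard n *ᵥ _) = _
        rw [← Matrix.mulVec_add]
        congr 1
        ext j
        simp [hp, hm]
        ring
      rw [Sum.elim_inl, h, Matrix.mulVec_smul, Matrix.mulVec_smul, ih]
      simp [pow_succ]
      ring
    · have h : (fun j => Sum.elim (hadamard n *ᵥ yp) (hadamard n *ᵥ ym) (Sum.inl j) -
          Sum.elim (hadamard n *ᵥ yp) (hadamard n *ᵥ ym) (Sum.inr j)) =
          hadamard n *ᵥ ((2 : ℝ) • fun j => y (halves n (Sum.inr j))) := by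
        change (hadamard n *ᵥ _) - (hadamard n *ᵥ _) = _
        rw [← Matrix.mulVec_sub]
        congr 1
        ext j
        simp [hp, hm]
        ring
      rw [Sum.elim_inr, h, Matrix.mulVec_smul, Matrix.mulVec_smul, ih]
      simp [pow_succ]
      ring

lemma measurable_hadamard_mulVec (n : ℕ) : Measurable fun y : Fin (2 ^ n) → ℝ => hadamard n *ᵥ y :=
  (Matrix.mulVecLin (hadamard n)).continuous_of_finiteDimensional.measurable

/-! ### Recursion on the first label -/

/-- The index is built by appending last digits, whereas the Hadamard recursion peels off the most
significant one. `erasureValue_succ` makes the same change of direction for the values. -/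
lemma pathIndex_succ_val (b : ℕ → Bool) (n : ℕ) :
    (pathIndex b (n + 1) : ℕ) = (b 0).toNat * 2 ^ n + pathIndex (fun k => b (k + 1)) n := by
  induction n with
  | zero => simp [pathIndex]
  | succ n ih =>
    have h1 : (pathIndex b (n + 1 + 1) : ℕ) = 2 * pathIndex b (n + 1) + (b (n + 1)).toNat := rfl
    have h2 : (pathIndex (fun k => b (k + 1)) (n + 1) : ℕ) =
      2 * pathIndex (fun k => b (k + 1)) n + (b (n + 1)).toNat := rfl
    rw [h1, h2, ih]
    ring

lemma pathIndex_succ_of_false {b : ℕ → Bool} (hb : b 0 = false) (n : ℕ) :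
    pathIndex b (n + 1) = halves n (Sum.inl (pathIndex (fun k => b (k + 1)) n)) := by
  ext
  rw [pathIndex_succ_val, halves_inl_val, hb]
  simp

lemma pathIndex_succ_of_true {b : ℕ → Bool} (hb : b 0 = true) (n : ℕ) :
    pathIndex b (n + 1) = halves n (Sum.inr (pathIndex (fun k => b (k + 1)) n)) := by
  ext
  rw [pathIndex_succ_val, halves_inr_val, hb]
  simp

lemma erasureValue_succ (α : ℝ) (b : ℕ → Bool) (n : ℕ) :
    erasureValue α b (n + 1) =
      erasureValue (if b 0 then α ^ 2 else 2 * α - α ^ 2) (fun k => b (k + 1)) n := by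
  induction n with
  | zero => simp [erasureValue]
  | succ n ih => rw [erasureValue, ih]; rfl

/-! ### The polarization tree of an erasure pair -/

/-- A block of 2N i.i.d. samples is a block of N i.i.d. pairs, position j of the first half being
paired with position j of the second. -/
lemma map_pi_pairs {S ι κ : Type*} [MeasurableSpace S] [Fintype ι] [Fintype κ] (e : ι ⊕ ι ≃ κ)
    (μ : Measure S) [IsProbabilityMeasure μ] :
    (Measure.pi fun _ : κ => μ).map (fun z j => (z (e (Sum.inl j)), z (e (Sum.inr j)))) =
      Measure.pi fun _ : ι => μ.prod μ := by
  have h1 := (measurePreserving_piCongrLeft (fun _ : κ => μ) e).symm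
  have h2 := measurePreserving_sumPiEquivProdPi (fun _ : ι ⊕ ι => μ)
  have h3 := (measurePreserving_arrowProdEquivProdArrow S S ι (fun _ => μ) (fun _ => μ)).symm
  exact ((h3.comp h2).comp h1).map_eq

section Tree

variable {𝓥 : Type*} [MeasurableSpace 𝓥]

/-- The transformed variable of index `i`, with its side information: the previous transformed
variables and the side information of the block. -/
def treeMap (n : ℕ) (i : Fin (2 ^ n)) (z : Fin (2 ^ n) → ℝ × 𝓥) :
    ℝ × (({j : Fin (2 ^ n) // j < i} → ℝ) × (Fin (2 ^ n) → 𝓥)) :=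
  ((hadamard n *ᵥ fun j => (z j).1) i,
    (fun j => (hadamard n *ᵥ fun j => (z j).1) j, fun j => (z j).2))

lemma measurable_treeMap (n : ℕ) (i : Fin (2 ^ n)) :
    Measurable (treeMap n i : (Fin (2 ^ n) → ℝ × 𝓥) → _) := by
  have h : Measurable fun z : Fin (2 ^ n) → ℝ × 𝓥 => hadamard n *ᵥ fun j => (z j).1 :=
    (measurable_hadamard_mulVec n).comp (by fun_prop)
  have h' (i : Fin (2 ^ n)) : Measurable fun z : Fin (2 ^ n) → ℝ × 𝓥 =>
      (hadamard n *ᵥ fun j => (z j).1) i := (measurable_pi_apply i).comp h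
  have h'' : Measurable fun (z : Fin (2 ^ n) → ℝ × 𝓥) (j : {j : Fin (2 ^ n) // j < i}) =>
      (hadamard n *ᵥ fun j => (z j).1) j := measurable_pi_iff.2 fun j => h' j
  exact (h' i).prodMk (h''.prodMk (by fun_prop))

lemma map_pi_map_pairs {𝓦 : Type*} [MeasurableSpace 𝓦] (n : ℕ) (μ : Measure (ℝ × 𝓥))
    [IsProbabilityMeasure μ] {Φ : (ℝ × 𝓥) × (ℝ × 𝓥) → ℝ × 𝓦} (hΦ : Measurable Φ) :
    (Measure.pi fun _ : Fin (2 ^ n) => (μ.prod μ).map Φ) =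
      (Measure.pi fun _ : Fin (2 ^ (n + 1)) => μ).map
        (fun z j => Φ (z (halves n (Sum.inl j)), z (halves n (Sum.inr j)))) := by
  have : IsProbabilityMeasure ((μ.prod μ).map Φ) :=
    Measure.isProbabilityMeasure_map hΦ.aemeasurable
  rw [← Measure.pi_map_pi (fun _ => hΦ.aemeasurable), ← map_pi_pairs (halves n) μ,
    Measure.map_map (by fun_prop) (by fun_prop)]
  rfl

lemma halves_inl_lt_inl {n : ℕ} {i j : Fin (2 ^ n)} :
    halves n (Sum.inl j) < halves n (Sum.inl i) ↔ j < i := by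
  rw [Fin.lt_def, Fin.lt_def, halves_inl_val, halves_inl_val]

lemma halves_inr_lt_inr {n : ℕ} {i j : Fin (2 ^ n)} :
    halves n (Sum.inr j) < halves n (Sum.inr i) ↔ j < i := by
  rw [Fin.lt_def, Fin.lt_def, halves_inr_val, halves_inr_val, add_lt_add_iff_left]

lemma halves_inl_lt_inr {n : ℕ} (i j : Fin (2 ^ n)) :
    halves n (Sum.inl j) < halves n (Sum.inr i) := by
  rw [Fin.lt_def, halves_inr_val, halves_inl_val]
  omega

lemma not_halves_inr_lt_inl {n : ℕ} (i j : Fin (2 ^ n)) :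
    ¬ halves n (Sum.inr j) < halves n (Sum.inl i) :=
  not_lt.2 (halves_inl_lt_inr j i).le

lemma measurable_sumElim_apply {A B C D : Type*} [MeasurableSpace C] [MeasurableSpace D]
    {f : D → A → C} {g : D → B → C} (hf : ∀ a, Measurable fun u => f u a)
    (hg : ∀ a, Measurable fun u => g u a) (s : A ⊕ B) :
    Measurable fun u => Sum.elim (f u) (g u) s := by
  rcases s with s | s
  exacts [hf s, hg s]

lemma measurable_dite_apply {A D : Type*} [MeasurableSpace D] {p : A → Prop} [DecidablePred p]
    {f : D → {a // p a} → ℝ} (hf : ∀ a, Measurable fun u => f u a) (a : A) :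
    Measurable fun u => if h : p a then f u ⟨a, h⟩ else 0 := by
  by_cases h : p a
  · simpa [h] using hf _
  · simp [h]

/-- Relabelling of the side information at a label `+`. -/
def plusLabel (n : ℕ) (i : Fin (2 ^ n))
    (u : ({j : Fin (2 ^ n) // j < i} → ℝ) × (Fin (2 ^ n) → 𝓥 × 𝓥)) :
    ({j : Fin (2 ^ (n + 1)) // j < halves n (Sum.inl i)} → ℝ) × (Fin (2 ^ (n + 1)) → 𝓥) :=
  -- The zeros are never taken: an index below `halves n (Sum.inl i)` is in the first half and comes
  -- from some j < i.
  (fun j => Sum.elim (fun j => if h : j < i then u.1 ⟨j, h⟩ else 0) 0 ((halves n).symm j),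
    fun j => Sum.elim (fun j => (u.2 j).1) (fun j => (u.2 j).2) ((halves n).symm j))

/-- Relabelling of the side information at a label `-`. -/
def minusLabel (n : ℕ) (i : Fin (2 ^ n))
    (u : ({j : Fin (2 ^ n) // j < i} → ℝ) × (Fin (2 ^ n) → ℝ × (𝓥 × 𝓥))) :
    ({j : Fin (2 ^ (n + 1)) // j < halves n (Sum.inr i)} → ℝ) × (Fin (2 ^ (n + 1)) → 𝓥) :=
  (fun j => Sum.elim (hadamard n *ᵥ fun j => (u.2 j).1)
      (fun j => if h : j < i then u.1 ⟨j, h⟩ else 0) ((halves n).symm j),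
    fun j => Sum.elim (fun j => (u.2 j).2.1) (fun j => (u.2 j).2.2) ((halves n).symm j))

lemma measurable_plusLabel (n : ℕ) (i : Fin (2 ^ n)) :
    Measurable (plusLabel n i : (_ → ℝ) × (_ → 𝓥 × 𝓥) → _) := by
  refine (measurable_pi_lambda _ fun j => ?_).prodMk (measurable_pi_lambda _ fun j => ?_)
  · exact measurable_sumElim_apply (measurable_dite_apply fun a => by fun_prop)
      (fun a => measurable_const) _
  · exact measurable_sumElim_apply (fun a => by fun_prop) (fun a => by fun_prop) _

lemma measurable_minusLabel (n : ℕ) (i : Fin (2 ^ n)) :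
    Measurable (minusLabel n i : (_ → ℝ) × (_ → ℝ × (𝓥 × 𝓥)) → _) := by
  refine (measurable_pi_lambda _ fun j => ?_).prodMk (measurable_pi_lambda _ fun j => ?_)
  · exact measurable_sumElim_apply (fun a => (measurable_pi_apply a).comp
      ((measurable_hadamard_mulVec n).comp (by fun_prop)))
      (measurable_dite_apply fun a => by fun_prop) _
  · exact measurable_sumElim_apply (fun a => by fun_prop) (fun a => by fun_prop) _

lemma IsErasurePair.relabel {A 𝓦 : Type*} [MeasurableSpace A] [MeasurableSpace 𝓦] {ν : Measure A}
    {d : ℝ} {T : A → ℝ × 𝓥} {T' : A → ℝ × 𝓦} (h : IsErasurePair (ν.map T) d) (hT : Measurable T)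
    {g : 𝓥 → 𝓦} (hg : Measurable g) {g' : 𝓦 → 𝓥} (hg' : Measurable g') (hgg' : ∀ v, g' (g v) = v)
    (hT' : ∀ a, T' a = ((T a).1, g (T a).2)) : IsErasurePair (ν.map T') d := by
  have h1 := h.map_snd hg hg' (ae_of_all _ fun z => hgg' z.2)
  rw [Measure.map_map (by fun_prop) hT] at h1
  rwa [show T' = (fun z : ℝ × 𝓥 => (z.1, g z.2)) ∘ T from funext hT']

/-- Two blocks of half the length, with the sums, are as good as one block. -/
lemma IsErasurePair.treeMap_inl {μ : Measure (ℝ × 𝓥)} [IsProbabilityMeasure μ] {n : ℕ}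
    {i : Fin (2 ^ n)} {d : ℝ}
    (h : IsErasurePair ((Measure.pi fun _ : Fin (2 ^ n) => (μ.prod μ).map
      fun z => (z.1.1 + z.2.1, (z.1.2, z.2.2))).map (treeMap n i)) d) :
    IsErasurePair ((Measure.pi fun _ : Fin (2 ^ (n + 1)) => μ).map
      (treeMap (n + 1) (halves n (Sum.inl i)))) d := by
  rw [map_pi_map_pairs n μ (by fun_prop),
    Measure.map_map (measurable_treeMap _ _) (by fun_prop)] at h
  refine h.relabel ((measurable_treeMap _ _).comp (by fun_prop)) (measurable_plusLabel n i)
    (g' := fun u => (fun j => u.1 ⟨halves n (Sum.inl j), halves_inl_lt_inl.2 j.2⟩,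
      fun j => (u.2 (halves n (Sum.inl j)), u.2 (halves n (Sum.inr j)))))
    (by fun_prop) (fun u => ?_) (fun z => ?_)
  · refine Prod.ext (funext fun j => ?_) (funext fun j => ?_)
    · simp [plusLabel, -not_lt, show j.1 < i from j.2]
    · simp [plusLabel]
  refine Prod.ext ?_ (Prod.ext (funext fun j => ?_) (funext fun j => ?_))
  · simp [treeMap, hadamard_succ_mulVec]
  · obtain ⟨j, hj⟩ := j
    obtain ⟨s, rfl⟩ := (halves n).surjective j
    rcases s with s | s
    · simp [treeMap, plusLabel, hadamard_succ_mulVec, halves_inl_lt_inl.1 hj]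
    · exact absurd hj (not_halves_inr_lt_inl i s)
  · obtain ⟨s, rfl⟩ := (halves n).surjective j
    rcases s with s | s <;> simp [treeMap, plusLabel]

/-- Two blocks of half the length, with the differences given the sums, are as good as one
block. -/
lemma IsErasurePair.treeMap_inr {μ : Measure (ℝ × 𝓥)} [IsProbabilityMeasure μ] {n : ℕ}
    {i : Fin (2 ^ n)} {d : ℝ}
    (h : IsErasurePair ((Measure.pi fun _ : Fin (2 ^ n) => (μ.prod μ).map
      fun z => (z.1.1 - z.2.1, (z.1.1 + z.2.1, (z.1.2, z.2.2)))).map (treeMap n i)) d) :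
    IsErasurePair ((Measure.pi fun _ : Fin (2 ^ (n + 1)) => μ).map
      (treeMap (n + 1) (halves n (Sum.inr i)))) d := by
  rw [map_pi_map_pairs n μ (by fun_prop),
    Measure.map_map (measurable_treeMap _ _) (by fun_prop)] at h
  refine h.relabel ((measurable_treeMap _ _).comp (by fun_prop)) (measurable_minusLabel n i)
    -- The whole first half precedes this index, so the full Hadamard transform of the sums is
    -- available; a second transform and the factor 2^{-n} return the sums.
    (g' := fun u => (fun j => u.1 ⟨halves n (Sum.inr j), halves_inr_lt_inr.2 j.2⟩,
      fun j => ((((2 : ℝ) ^ n)⁻¹ • (hadamard n *ᵥ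
        fun j => u.1 ⟨halves n (Sum.inl j), halves_inl_lt_inr i j⟩)) j,
        (u.2 (halves n (Sum.inl j)), u.2 (halves n (Sum.inr j))))))
    ?_ (fun u => ?_) (fun z => ?_)
  · refine Measurable.prodMk (by fun_prop) (measurable_pi_lambda _ fun j => ?_)
    refine Measurable.prodMk ?_ (by fun_prop)
    have : Measurable fun u : ({j : Fin (2 ^ (n + 1)) // j < halves n (Sum.inr i)} → ℝ) ×
        (Fin (2 ^ (n + 1)) → 𝓥) =>
        fun j => u.1 ⟨halves n (Sum.inl j), halves_inl_lt_inr i j⟩ := by fun_prop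
    exact (measurable_pi_apply j).comp
      (((measurable_hadamard_mulVec n).comp this).const_smul ((2 : ℝ) ^ n)⁻¹)
  · refine Prod.ext (funext fun j => ?_) (funext fun j => ?_)
    · simp [minusLabel, -not_lt, show j.1 < i from j.2]
    · have : (fun j => (minusLabel n i u).1 ⟨halves n (Sum.inl j), halves_inl_lt_inr i j⟩) =
          hadamard n *ᵥ fun j => (u.2 j).1 := by
        ext j
        simp [minusLabel]
      simp only [this, hadamard_mulVec_hadamard_mulVec]
      simp [minusLabel]
  refine Prod.ext ?_ (Prod.ext (funext fun j => ?_) (funext fun j => ?_))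
  · simp [treeMap, hadamard_succ_mulVec]
  · obtain ⟨j, hj⟩ := j
    obtain ⟨s, rfl⟩ := (halves n).surjective j
    rcases s with s | s
    · simp [treeMap, minusLabel, hadamard_succ_mulVec]
    · simp [treeMap, minusLabel, hadamard_succ_mulVec, halves_inr_lt_inr.1 hj]
  · obtain ⟨s, rfl⟩ := (halves n).surjective j
    rcases s with s | s <;> simp [treeMap, minusLabel]

/-- The law of each transformed variable and its side information is an erasure pair, with the
parameter of the erasure process. -/
theorem IsErasurePair.tree {μ : Measure (ℝ × 𝓥)} [IsProbabilityMeasure μ] {α : ℝ}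
    (h : IsErasurePair μ α) (n : ℕ) (b : ℕ → Bool) :
    IsErasurePair ((Measure.pi fun _ : Fin (2 ^ n) => μ).map (treeMap n (pathIndex b n)))
      (erasureValue α b n) := by
  -- The transformed source carries larger side information, so the type `𝓥` must vary along the
  -- induction.
  induction n generalizing 𝓥 α b with
  | zero =>
    have h1 := (measurePreserving_eval (fun _ : Fin (2 ^ 0) => μ) 0).map_eq
    rw [← h1] at h
    refine h.relabel (measurable_pi_apply _) (g := fun v => ((fun _ => 0, fun _ => v) :
      ({j : Fin (2 ^ 0) // j < pathIndex b 0} → ℝ) × (Fin (2 ^ 0) → 𝓥))) (by fun_prop)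
      (g' := fun u => u.2 0) (by fun_prop) (fun v => rfl) fun z => ?_
    refine Prod.ext ?_ (Prod.ext (funext fun j => ?_) (funext fun j => ?_))
    · simp [treeMap, hadamard, pathIndex]
    · exact absurd j.2 (by simp [pathIndex])
    · have : j = 0 := Subsingleton.elim (α := Fin 1) _ _
      simp [treeMap, this]
  | succ n ih =>
    rw [erasureValue_succ]
    cases hb : b 0
    · rw [pathIndex_succ_of_false hb]
      refine IsErasurePair.treeMap_inl ?_
      have : IsProbabilityMeasure ((μ.prod μ).map
          fun z : (ℝ × 𝓥) × (ℝ × 𝓥) => (z.1.1 + z.2.1, (z.1.2, z.2.2))) :=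
        Measure.isProbabilityMeasure_map (by fun_prop)
      have hs : α + α - α * α = if false = true then α ^ 2 else 2 * α - α ^ 2 := by
        rw [if_neg (by simp)]
        ring
      exact hs ▸ ih (h.add h) (fun k => b (k + 1))
    · rw [pathIndex_succ_of_true hb]
      refine IsErasurePair.treeMap_inr ?_
      have : IsProbabilityMeasure ((μ.prod μ).map
          fun z : (ℝ × 𝓥) × (ℝ × 𝓥) => (z.1.1 - z.2.1, (z.1.1 + z.2.1, (z.1.2, z.2.2)))) :=
        Measure.isProbabilityMeasure_map (by fun_prop)
      have hs : α * α = if true = true then α ^ 2 else 2 * α - α ^ 2 := by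
        rw [if_pos rfl]
        ring
      exact hs ▸ ih (h.sub h) (fun k => b (k + 1))

end Tree

/-! ### Martingale property and polarization of an erasure process -/

lemma erasureValue_mem_Icc {α : ℝ} (hα : α ∈ Set.Icc (0 : ℝ) 1) (b : ℕ → Bool) (n : ℕ) :
    erasureValue α b n ∈ Set.Icc (0 : ℝ) 1 := by
  induction n with
  | zero => exact hα
  | succ n ih =>
    obtain ⟨h0, h1⟩ := ih
    rw [erasureValue]
    split_ifs <;> constructor <;> nlinarith

/-- The sign of a label. -/
def labelSign (x : Bool) : ℝ := if x then -1 else 1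

/-- The increment is e(1 - e) times a sign. A fair sign independent of the past gives the martingale
property, and the size of the increment gives polarization. -/
lemma erasureValue_succ_eq_add (α : ℝ) (b : ℕ → Bool) (n : ℕ) :
    erasureValue α b (n + 1) = erasureValue α b n +
      erasureValue α b n * (1 - erasureValue α b n) * labelSign (b n) := by
  rw [erasureValue, labelSign]
  split_ifs <;> ring

section Labels

variable {Ω' : Type*} [MeasurableSpace Ω'] {Q : Measure Ω'} {B : ℕ → Ω' → Bool}

lemma measurable_label_labelFiltration (hB : ∀ k, Measurable (B k)) {k n : ℕ} (hk : k < n) :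
    Measurable[labelFiltration B hB n] (B k) :=
  Measurable.mono (comap_measurable (B k))
    (le_iSup (fun k : Fin n => MeasurableSpace.comap (B k) inferInstance) ⟨k, hk⟩) le_rfl

lemma stronglyMeasurable_erasureValue (hB : ∀ k, Measurable (B k)) (α : ℝ) (n : ℕ) :
    StronglyMeasurable[labelFiltration B hB n] fun ω => erasureValue α (fun k => B k ω) n := by
  induction n with
  | zero => exact stronglyMeasurable_const
  | succ n ih =>
    have h1 := ih.mono ((labelFiltration B hB).mono n.le_succ)
    have h2 : StronglyMeasurable[labelFiltration B hB (n + 1)] fun ω => labelSign (B n ω) :=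
      ((measurable_of_finite labelSign).comp
        (measurable_label_labelFiltration hB n.lt_succ_self)).stronglyMeasurable
    simp_rw [erasureValue_succ_eq_add]
    exact h1.add ((h1.mul (stronglyMeasurable_const.sub h1)).mul h2)

lemma indep_label_labelFiltration (hB : ∀ k, Measurable (B k)) (hindep : iIndepFun B Q) (n : ℕ) :
    Indep (MeasurableSpace.comap (B n) inferInstance) (labelFiltration B hB n) Q := by
  have h := indep_iSup_of_disjoint (fun k => (hB k).comap_le) hindep
    (S := {n}) (T := Set.Iio n) (by simp)
  have h1 : (⨆ k ∈ ({n} : Set ℕ), MeasurableSpace.comap (B k) inferInstance) =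
      MeasurableSpace.comap (B n) inferInstance := by simp
  have h2 : (⨆ k ∈ Set.Iio n, MeasurableSpace.comap (B k) inferInstance) =
      labelFiltration B hB n := by
    refine le_antisymm (iSup₂_le fun k hk => ?_) (iSup_le fun k => ?_)
    · exact le_iSup (fun k : Fin n => MeasurableSpace.comap (B k) inferInstance) ⟨k, hk⟩
    · exact le_iSup₂_of_le (k : ℕ) k.2 le_rfl
  rwa [h1, h2] at h

variable [IsProbabilityMeasure Q]

lemma integral_labelSign (hB : ∀ k, Measurable (B k))
    (hunif : ∀ k b, Q.real {ω | B k ω = b} = 1 / 2) (n : ℕ) :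
    ∫ ω, labelSign (B n ω) ∂Q = 0 := by
  have h (b : Bool) : (Q.map (B n)).real {b} = 1 / 2 := by
    rw [map_measureReal_apply (hB n) (measurableSet_singleton _)]
    exact hunif n b
  have : IsProbabilityMeasure (Q.map (B n)) :=
    Measure.isProbabilityMeasure_map (hB n).aemeasurable
  rw [← integral_map (φ := B n) (f := labelSign) (hB n).aemeasurable
    (measurable_of_finite _).aestronglyMeasurable,
    integral_fintype Integrable.of_finite]
  simp [h, labelSign]

lemma martingale_erasureValue (hB : ∀ k, Measurable (B k)) (hindep : iIndepFun B Q)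
    (hunif : ∀ k b, Q.real {ω | B k ω = b} = 1 / 2) {α : ℝ} (hα : α ∈ Set.Icc (0 : ℝ) 1) :
    Martingale (fun n ω => erasureValue α (fun k => B k ω) n) (labelFiltration B hB) Q := by
  set M : ℕ → Ω' → ℝ := fun n ω => erasureValue α (fun k => B k ω) n with hM
  have hsm (n : ℕ) : StronglyMeasurable[labelFiltration B hB n] (M n) :=
    stronglyMeasurable_erasureValue hB α n
  have hle (n : ℕ) := (labelFiltration B hB).le n
  have hint (n : ℕ) : Integrable (M n) Q := by
    refine Integrable.of_bound ((hsm n).mono (hle n)).aestronglyMeasurable 1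
      (ae_of_all _ fun ω => ?_)
    have := erasureValue_mem_Icc hα (fun k => B k ω) n
    rw [Real.norm_eq_abs, abs_le]
    exact ⟨by linarith [this.1], this.2⟩
  refine martingale_nat hsm hint fun n => ?_
  set s : Ω' → ℝ := fun ω => labelSign (B n ω) with hs
  set g : Ω' → ℝ := fun ω => M n ω * (1 - M n ω) with hg
  have hgm : StronglyMeasurable[labelFiltration B hB n] g :=
    (hsm n).mul (stronglyMeasurable_const.sub (hsm n))
  have hsint : Integrable s Q := by
    refine Integrable.of_bound ((measurable_of_finite labelSign).comp (hB n)).aestronglyMeasurable 1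
      (ae_of_all _ fun ω => ?_)
    simp only [hs, labelSign]
    split_ifs <;> simp
  have hsucc : M (n + 1) = M n + g * s := by
    ext ω
    exact erasureValue_succ_eq_add α _ n
  have hgs : Integrable (g * s) Q := by
    have := (hint (n + 1)).sub (hint n)
    rwa [hsucc, add_sub_cancel_left] at this
  have h1 : Q[s | labelFiltration B hB n] =ᵐ[Q] fun _ => 0 := by
    have := condExp_indep_eq (μ := Q) (hB n).comap_le (hle n) (f := s)
      ((measurable_of_finite labelSign).comp (comap_measurable (B n))).stronglyMeasurable
      (indep_label_labelFiltration hB hindep n)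
    rwa [integral_labelSign hB hunif n] at this
  have h2 := condExp_mul_of_stronglyMeasurable_left (μ := Q) hgm hgs hsint
  have h3 := condExp_add (hint n) hgs (labelFiltration B hB n)
  have h4 := condExp_of_stronglyMeasurable (hle n) (hsm n) (hint n)
  rw [hsucc]
  filter_upwards [h1, h2, h3] with ω h1 h2 h3
  rw [h3, Pi.add_apply, h4, h2, Pi.mul_apply, h1, mul_zero, add_zero]

/-- A bounded martingale converges, so its increments ± M(1 - M) tend to 0 and the limit is 0 or 1.
Dominated convergence preserves the mean, which is the probability of the limit 1. -/
lemma polarizes_erasureValue (hB : ∀ k, Measurable (B k)) (hindep : iIndepFun B Q)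
    (hunif : ∀ k b, Q.real {ω | B k ω = b} = 1 / 2) {α : ℝ} (hα : α ∈ Set.Icc (0 : ℝ) 1) :
    PolarizesTo01 Q (fun n ω => erasureValue α (fun k => B k ω) n) α := by
  set M : ℕ → Ω' → ℝ := fun n ω => erasureValue α (fun k => B k ω) n with hM
  have hmart : Martingale M (labelFiltration B hB) Q := martingale_erasureValue hB hindep hunif hα
  have hbound (n : ℕ) (ω : Ω') : ‖M n ω‖ ≤ 1 := by
    have := erasureValue_mem_Icc hα (fun k => B k ω) n
    rw [Real.norm_eq_abs, abs_le]
    exact ⟨by linarith [this.1], this.2⟩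
  have hnorm (n : ℕ) : eLpNorm (M n) 1 Q ≤ ((1 : ℝ≥0) : ℝ≥0∞) := by
    refine (eLpNorm_le_of_ae_bound (C := 1) (ae_of_all _ (hbound n))).trans ?_
    simp
  have hconv := hmart.submartingale.ae_tendsto_limitProcess hnorm
  set L := Filtration.limitProcess M (labelFiltration B hB) Q
  have hLm : Measurable L :=
    (Filtration.stronglyMeasurable_limit_process' (ℱ := labelFiltration B hB)).measurable
  have hset : MeasurableSet {ω | L ω = 1} := hLm (measurableSet_singleton 1)
  have h01 : ∀ᵐ ω ∂Q, L ω = 0 ∨ L ω = 1 := by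
    filter_upwards [hconv] with ω hω
    have h1 : Tendsto (fun n => (M (n + 1) ω - M n ω) ^ 2) atTop (𝓝 ((L ω - L ω) ^ 2)) :=
      (((tendsto_add_atTop_iff_nat 1).2 hω).sub hω).pow 2
    have h2 : Tendsto (fun n => (M n ω * (1 - M n ω)) ^ 2) atTop (𝓝 ((L ω * (1 - L ω)) ^ 2)) :=
      (hω.mul (tendsto_const_nhds.sub hω)).pow 2
    have h3 : (fun n => (M (n + 1) ω - M n ω) ^ 2) = fun n => (M n ω * (1 - M n ω)) ^ 2 := by
      ext n
      simp only [hM, erasureValue_succ_eq_add, labelSign]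
      split_ifs <;> ring
    rw [h3] at h1
    have h4 := tendsto_nhds_unique h1 h2
    rw [sub_self, zero_pow two_ne_zero, eq_comm, sq_eq_zero_iff, mul_eq_zero] at h4
    exact h4.imp id fun h => by linarith
  -- The martingale limit is {0, 1}-valued only almost surely; the indicator is so everywhere.
  set eInf : Ω' → ℝ := {ω | L ω = 1}.indicator fun _ => 1 with heInf
  have hlim : ∀ᵐ ω ∂Q, Tendsto (fun n => M n ω) atTop (𝓝 (eInf ω)) := by
    filter_upwards [hconv, h01] with ω hω h
    rcases h with h | h
    · rw [heInf, Set.indicator_of_notMem (by simp [h]), ← h]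
      exact hω
    · rw [heInf, Set.indicator_of_mem (by exact h), ← h]
      exact hω
  have hval (ω : Ω') : eInf ω = 1 ↔ ω ∈ {ω | L ω = 1} := by
    simp [heInf, Set.indicator_apply]
  refine ⟨eInf, measurable_const.indicator hset, fun ω => ?_, hlim, ?_⟩
  · by_cases h : ω ∈ {ω | L ω = 1}
    · exact Or.inr ((hval ω).2 h)
    · exact Or.inl (Set.indicator_of_notMem h _)
  · have h1 : Tendsto (fun n => ∫ ω, M n ω ∂Q) atTop (𝓝 (∫ ω, eInf ω ∂Q)) :=
      tendsto_integral_of_dominated_convergence (fun _ => 1)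
        (fun n => (hmart.integrable n).aestronglyMeasurable) (integrable_const 1)
        (fun n => ae_of_all _ (hbound n)) hlim
    have h2 (n : ℕ) : ∫ ω, M n ω ∂Q = α := by
      have := hmart.setIntegral_eq (Nat.zero_le n) (s := Set.univ) MeasurableSet.univ
      rw [setIntegral_univ, setIntegral_univ] at this
      rw [← this]
      simp [hM, erasureValue]
    simp_rw [h2] at h1
    have h3 := tendsto_nhds_unique h1 tendsto_const_nhds
    rw [heInf, integral_indicator_const _ hset, smul_eq_mul, mul_one] at h3
    rw [show {ω | eInf ω = 1} = {ω | L ω = 1} from Set.ext hval]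
    exact h3

end Labels

/-! ### Binary labels of an index -/

lemma pathIndex_surjective (n : ℕ) (i : Fin (2 ^ n)) : ∃ b, pathIndex b n = i := by
  induction n with
  | zero => exact ⟨fun _ => false, Subsingleton.elim (α := Fin 1) _ _⟩
  | succ n ih =>
    obtain ⟨s, rfl⟩ := (halves n).surjective i
    rcases s with s | s
    · obtain ⟨b, rfl⟩ := ih s
      exact ⟨fun k => k.casesOn false b, pathIndex_succ_of_false rfl n⟩
    · obtain ⟨b, rfl⟩ := ih s
      exact ⟨fun k => k.casesOn true b, pathIndex_succ_of_true rfl n⟩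

/-- Binary expansions of length n are unique, which makes the choice of path in `erasureArray`
harmless. -/
lemma erasureValue_eq_of_pathIndex_eq (α : ℝ) {b b' : ℕ → Bool} {n : ℕ}
    (h : pathIndex b n = pathIndex b' n) : erasureValue α b n = erasureValue α b' n := by
  induction n with
  | zero => rfl
  | succ n ih =>
    have h1 : 2 * (pathIndex b n : ℕ) + (b n).toNat = 2 * (pathIndex b' n : ℕ) + (b' n).toNat :=
      congrArg Fin.val h
    have h2 := Bool.toNat_le (b n)
    have h3 := Bool.toNat_le (b' n)
    have h4 : pathIndex b n = pathIndex b' n := Fin.ext (by omega)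
    have h5 : b n = b' n := by
      have : (b n).toNat = (b' n).toNat := by omega
      revert this
      cases b n <;> cases b' n <;> simp
    rw [erasureValue, erasureValue, ih h4, h5]

/-- The erasure process as an array indexed by binary expansions. -/
def erasureArray (α : ℝ) (n : ℕ) (i : Fin (2 ^ n)) : ℝ :=
  erasureValue α (pathIndex_surjective n i).choose n

lemma erasureArray_pathIndex (α : ℝ) (b : ℕ → Bool) (n : ℕ) :
    erasureArray α n (pathIndex b n) = erasureValue α b n :=
  erasureValue_eq_of_pathIndex_eq α (pathIndex_surjective n (pathIndex b n)).choose_spec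

lemma labelProcess_erasureArray {Ω' : Type*} (B : ℕ → Ω' → Bool) (α : ℝ) :
    labelProcess B (erasureArray α) = fun n ω => erasureValue α (fun k => B k ω) n := by
  ext n ω
  exact erasureArray_pathIndex α _ n

/-! ### Blocks of independent copies of an erasure pair -/

section Source

variable {Ω 𝓥 : Type*} [MeasurableSpace Ω] [MeasurableSpace 𝓥] {P : Measure Ω}
  [IsProbabilityMeasure P]

lemma IsErasurePair.block {S : ℕ → Ω → ℝ × 𝓥} (hS : ∀ i, Measurable (S i)) (hindep : iIndepFun S P)
    (hident : ∀ i, P.map (S i) = P.map (S 0)) {d : ℝ} (h : IsErasurePair (P.map (S 0)) d) (n : ℕ)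
    (i : Fin (2 ^ n)) :
    IsErasurePair (P.map fun ω => treeMap n i fun j => S j ω) (erasureArray d n i) := by
  have : IsProbabilityMeasure (P.map (S 0)) := Measure.isProbabilityMeasure_map (hS 0).aemeasurable
  have h1 : P.map (fun ω (j : Fin (2 ^ n)) => S j ω) = Measure.pi fun _ => P.map (S 0) := by
    have h2 : iIndepFun (fun j : Fin (2 ^ n) => S j) P := hindep.precomp Fin.val_injective
    rw [(iIndepFun_iff_map_fun_eq_pi_map (f := fun j : Fin (2 ^ n) => S j)
      fun j => (hS j).aemeasurable).1 h2]
    simp_rw [hident]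
  obtain ⟨b, rfl⟩ := pathIndex_surjective n i
  have h3 := h.tree n b
  rw [← h1, Measure.map_map (measurable_treeMap _ _) (measurable_pi_lambda _ fun j => hS j)] at h3
  rw [erasureArray_pathIndex]
  exact h3

end Source

section Base

variable {Ω : Type*} [MeasurableSpace Ω] {P : Measure Ω} [IsProbabilityMeasure P]

lemma InL.exists_isErasurePair {X Y : Ω → ℝ} (h : InL P fun ω => ![X ω, Y ω]) :
    (∃ d, IsErasurePair (P.map fun ω => (X ω, (0 : ℝ))) d) ∧
      ∃ d, IsErasurePair (P.map fun ω => (Y ω, X ω)) d := by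
  obtain ⟨k, A, E, hE, hindep, hns, hV⟩ := h
  have h0 : ∀ᵐ ω ∂P, X ω = ∑ j, A 0 j * E j ω ∧ Y ω = ∑ j, A 1 j * E j ω := by
    filter_upwards [hV] with ω hω
    exact ⟨congrFun hω 0, congrFun hω 1⟩
  constructor
  · obtain ⟨d, hd⟩ := exists_isErasurePair_linear hE hindep hns fun j => (A 0 j, 0)
    refine ⟨d, ?_⟩
    rwa [Measure.map_congr (g := ∑ j, fun ω => E j ω • ((A 0 j, 0) : ℝ × ℝ))]
    filter_upwards [h0] with ω hω
    rw [Finset.sum_apply]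
    ext <;> simp [Prod.fst_sum, Prod.snd_sum, hω.1, mul_comm]
  · obtain ⟨d, hd⟩ := exists_isErasurePair_linear hE hindep hns fun j => (A 1 j, A 0 j)
    refine ⟨d, ?_⟩
    rwa [Measure.map_congr (g := ∑ j, fun ω => E j ω • ((A 1 j, A 0 j) : ℝ × ℝ))]
    filter_upwards [h0] with ω hω
    rw [Finset.sum_apply]
    ext <;> simp [Prod.fst_sum, Prod.snd_sum, hω.1, hω.2, mul_comm]

lemma measurable_transform {X : ℕ → Ω → ℝ} (hX : ∀ i, Measurable (X i)) (n : ℕ) :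
    Measurable fun ω (i : Fin (2 ^ n)) => transform X n i ω :=
  (measurable_hadamard_mulVec n).comp (measurable_pi_lambda _ fun j => hX j)

lemma measurable_transform_lt {X : ℕ → Ω → ℝ} (hX : ∀ i, Measurable (X i)) (n : ℕ)
    (i : Fin (2 ^ n)) :
    Measurable fun ω (j : {j : Fin (2 ^ n) // j < i}) => transform X n j ω :=
  measurable_pi_iff.2 fun j => measurable_pi_iff.1 (measurable_transform hX n) j

lemma hasCondRID_transform {X : ℕ → Ω → ℝ} (hX : ∀ i, Measurable (X i)) (hindep : iIndepFun X P)
    (hident : ∀ i, P.map (X i) = P.map (X 0)) {d : ℝ}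
    (h : IsErasurePair (P.map fun ω => (X 0 ω, (0 : ℝ))) d) (n : ℕ) (i : Fin (2 ^ n)) :
    HasCondRID P (transform X n i)
      (fun ω (j : {j : Fin (2 ^ n) // j < i}) => transform X n j ω) (erasureArray d n i) := by
  have hX' (i : ℕ) : Measurable fun ω => (X i ω, (0 : ℝ)) := (hX i).prodMk measurable_const
  have h1 := h.block (S := fun i ω => (X i ω, (0 : ℝ))) hX'
    (hindep.comp (fun _ x => (x, (0 : ℝ))) fun _ => by fun_prop) (fun i => by
      have e (i : ℕ) : P.map (fun ω => (X i ω, (0 : ℝ))) =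
          (P.map (X i)).map fun x => (x, (0 : ℝ)) :=
        (Measure.map_map measurable_prodMk_right (hX i)).symm
      simp only [e, hident i]) n i
  have hm : Measurable fun ω => treeMap n i fun j => (X j ω, (0 : ℝ)) :=
    (measurable_treeMap n i).comp (measurable_pi_lambda _ fun j => hX' j)
  -- The dummy side information of X is constantly 0 and is discarded; it can be restored only
  -- almost everywhere under the law.
  have h2 := h1.map_snd (g := Prod.fst) measurable_fst
    (g' := fun u => (u, fun _ => (0 : ℝ))) (by fun_prop) (by
      refine (ae_map_iff hm.aemeasurable
        (p := fun z => (z.2.1, fun _ => (0 : ℝ)) = z.2)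
        (measurableSet_eq_fun ?_ measurable_snd)).2
        (ae_of_all _ fun ω => rfl)
      exact (measurable_fst.comp measurable_snd).prodMk measurable_const)
  rw [Measure.map_map (by fun_prop) hm] at h2
  exact IsErasurePair.hasCondRID (measurable_pi_iff.1 (measurable_transform hX n) i)
    (measurable_transform_lt hX n i) h2

lemma hasCondRID_transform_transform {X Y : ℕ → Ω → ℝ} (hX : ∀ i, Measurable (X i))
    (hY : ∀ i, Measurable (Y i)) (hindep : iIndepFun (fun i ω => (Y i ω, X i ω)) P)
    (hident : ∀ i, P.map (fun ω => (Y i ω, X i ω)) = P.map (fun ω => (Y 0 ω, X 0 ω))) {d : ℝ}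
    (h : IsErasurePair (P.map fun ω => (Y 0 ω, X 0 ω)) d) (n : ℕ) (i : Fin (2 ^ n)) :
    HasCondRID P (transform Y n i)
      (fun ω => ((fun j : {j : Fin (2 ^ n) // j < i} => transform Y n j ω),
        (fun j : Fin (2 ^ n) => transform X n j ω))) (erasureArray d n i) := by
  have hS (i : ℕ) : Measurable fun ω => (Y i ω, X i ω) := (hY i).prodMk (hX i)
  have h1 := h.block hS hindep hident n i
  have h2 := h1.relabel (T' := fun ω => (transform Y n i ω,
      ((fun j : {j : Fin (2 ^ n) // j < i} => transform Y n j ω),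
        (fun j : Fin (2 ^ n) => transform X n j ω))))
    ((measurable_treeMap n i).comp (measurable_pi_lambda _ fun j => hS j))
    (g := fun u => (u.1, hadamard n *ᵥ u.2))
    (measurable_fst.prodMk ((measurable_hadamard_mulVec n).comp measurable_snd))
    -- The tree conditions on the raw block of X, the theorem on its transform; the inverse
    -- transform identifies the two.
    (g' := fun u => (u.1, ((2 : ℝ) ^ n)⁻¹ • (hadamard n *ᵥ u.2)))
    (measurable_fst.prodMk
      (((measurable_hadamard_mulVec n).comp measurable_snd).const_smul ((2 : ℝ) ^ n)⁻¹))
    (fun u => by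
      simp only [hadamard_mulVec_hadamard_mulVec]
      rw [inv_smul_smul₀ (by positivity)])
    (fun ω => rfl)
  exact IsErasurePair.hasCondRID (measurable_pi_iff.1 (measurable_transform hY n) i)
    ((measurable_transform_lt hY n i).prodMk (measurable_transform hX n)) h2

end Base

end RIDPolar

end

/-! ### Assembly of the polarization theorem -/

theorem mainTheorem4
    {Ω : Type*} [MeasurableSpace Ω] (P : Measure Ω) [IsProbabilityMeasure P]
    (X Y : ℕ → Ω → ℝ) (hX : ∀ i, Measurable (X i)) (hY : ∀ i, Measurable (Y i))
    -- the two-terminal source is memoryless: the pairs are i.i.d., and they are in the space L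
    (hindep : iIndepFun (fun i ω => (X i ω, Y i ω)) P)
    (hident : ∀ i, IdentDistrib (fun ω => (X i ω, Y i ω)) (fun ω => (X 0 ω, Y 0 ω)) P P)
    (hL : RIDPolar.InL P (fun ω => ![X 0 ω, Y 0 ω]))
    -- i.i.d. uniform labels
    {Ω' : Type*} [MeasurableSpace Ω'] (Q : Measure Ω') [IsProbabilityMeasure Q]
    (B : ℕ → Ω' → Bool) (hB : ∀ k, Measurable (B k)) (hBindep : iIndepFun B Q)
    (hBunif : ∀ k b, Q.real {ω | B k ω = b} = 1 / 2) :
    ∃ (dX dYX : ℝ) (I J : (n : ℕ) → Fin (2 ^ n) → ℝ),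
      -- all information dimensions exist, and the four symbols denote them
      RIDPolar.HasRID P (X 0) dX ∧
      RIDPolar.HasCondRID P (Y 0) (X 0) dYX ∧
      (∀ (n : ℕ) (i : Fin (2 ^ n)),
        RIDPolar.HasCondRID P (RIDPolar.transform X n i)
          (fun ω (j : {j : Fin (2 ^ n) // j < i}) => RIDPolar.transform X n j ω) (I n i)) ∧
      (∀ (n : ℕ) (i : Fin (2 ^ n)),
        RIDPolar.HasCondRID P (RIDPolar.transform Y n i)
          (fun ω => ((fun j : {j : Fin (2 ^ n) // j < i} => RIDPolar.transform Y n j ω),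
            (fun j : Fin (2 ^ n) => RIDPolar.transform X n j ω))) (J n i)) ∧
      -- erasure processes with initial values d(X) and d(Y|X)
      RIDPolar.IsErasureProcess dX I ∧
      RIDPolar.IsErasureProcess dYX J ∧
      Martingale (RIDPolar.labelProcess B I) (RIDPolar.labelFiltration B hB) Q ∧
      Martingale (RIDPolar.labelProcess B J) (RIDPolar.labelFiltration B hB) Q ∧
      -- both polarize
      RIDPolar.PolarizesTo01 Q (RIDPolar.labelProcess B I) dX ∧
      RIDPolar.PolarizesTo01 Q (RIDPolar.labelProcess B J) dYX := by
  have hpair (i : ℕ) : Measurable fun ω => (X i ω, Y i ω) := (hX i).prodMk (hY i)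
  have hlaw (i : ℕ) : P.map (fun ω => (X i ω, Y i ω)) = P.map fun ω => (X 0 ω, Y 0 ω) :=
    (hident i).map_eq
  have hXind : iIndepFun X P := hindep.comp (fun _ z => z.1) fun _ => measurable_fst
  have hYX : iIndepFun (fun i ω => (Y i ω, X i ω)) P :=
    hindep.comp (fun _ => Prod.swap) fun _ => measurable_swap
  have hXlaw (i : ℕ) : P.map (X i) = P.map (X 0) := by
    have e (i : ℕ) : P.map (X i) = (P.map fun ω => (X i ω, Y i ω)).map Prod.fst :=
      (Measure.map_map measurable_fst (hpair i)).symm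
    rw [e i, e 0, hlaw i]
  have hYXlaw (i : ℕ) : P.map (fun ω => (Y i ω, X i ω)) = P.map fun ω => (Y 0 ω, X 0 ω) := by
    have e (i : ℕ) : P.map (fun ω => (Y i ω, X i ω)) =
        (P.map fun ω => (X i ω, Y i ω)).map Prod.swap :=
      (Measure.map_map measurable_swap (hpair i)).symm
    rw [e i, e 0, hlaw i]
  obtain ⟨⟨dX, hdX⟩, dYX, hdYX⟩ := hL.exists_isErasurePair
  have : IsProbabilityMeasure (P.map fun ω => (X 0 ω, (0 : ℝ))) :=
    Measure.isProbabilityMeasure_map ((hX 0).prodMk measurable_const).aemeasurable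
  have : IsProbabilityMeasure (P.map fun ω => (Y 0 ω, X 0 ω)) :=
    Measure.isProbabilityMeasure_map ((hY 0).prodMk (hX 0)).aemeasurable
  have hIX := hdX.mem_Icc
  have hIYX := hdYX.mem_Icc
  refine ⟨dX, dYX, RIDPolar.erasureArray dX, RIDPolar.erasureArray dYX,
    (hdX.hasCondRID (hX 0) measurable_const).hasRID (hX 0), hdYX.hasCondRID (hY 0) (hX 0),
    RIDPolar.hasCondRID_transform hX hXind hXlaw hdX,
    RIDPolar.hasCondRID_transform_transform hX hY hYX hYXlaw hdYX,
    ⟨hIX, RIDPolar.erasureArray_pathIndex dX⟩, ⟨hIYX, RIDPolar.erasureArray_pathIndex dYX⟩, ?_⟩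
  simp only [RIDPolar.labelProcess_erasureArray]
  exact ⟨RIDPolar.martingale_erasureValue hB hBindep hBunif hIX,
    RIDPolar.martingale_erasureValue hB hBindep hBunif hIYX,
    RIDPolar.polarizes_erasureValue hB hBindep hBunif hIX,
    RIDPolar.polarizes_erasureValue hB hBindep hBunif hIYX⟩
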